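/- **Setting.** A non-commutative probability space $(A,\varphi)$ is a unital complex algebra $A$ with a linear functional $\varphi:A\to\mathbb C$, $\varphi(1)=1$. The joint distribution of a family $(a_g)_{g\in G}$ in $A$ is the collection of its joint moments $\varphi(a_{g_1}\cdots a_{g_n})$, $n\ge 0$, $g_1,\dots,g_n\in G$; convergence in distribution is convergence of every joint moment. Families are free if the unital subalgebras they generate are free with respect to $\varphi$. A family $(s_l)_{l\in L}$ is a semicircular family of covariance $(c_{l,m})_{l,m\in L}$ if for all $n$ and $l_1,\dots,l_n\in L$ $$\varphi(s_{l_1}\cdots s_{l_n})=\sum_{\pi\in NC_2(n)}\ \prod_{\{p,q\}\in\pi,\,p<q}c_{l_p,l_q},$$ where $NC_2(n)$ is the set of non-crossing pairings of $\{1,\dots,n\}$. **Theorem 2.6.** Let $I,J$ be disjoint index sets, $L=I\sqcup J$, and let $K,K'$ be index sets. For $k\in K$ let $C_k=(c_{l,m;k})_{l,m\in L}$ be a positive semidefinite matrix with real entries. For each $N\in\mathbb N$ let $(\Omega_N,P_N)$ be a probability space with expectation $E$, and for $l\in L$, $k\in K$ let $Y^{l,k}_N=[Y^{l,k}_{i,j;N}]_{i,j=1}^N$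 be an $N\times N$ matrix with entries in $L^{\infty-}(\Omega_N,P_N)=\bigcap_{1\le p<\infty}L^p(\Omega_N,P_N)$. Suppose that for every $k\in K$: 1. $E(Y^{l,k}_{i,j;N})=0$ for all $N,i,j,l$; 2. $Y^{l,k}_{j,i;N}=\overline{Y^{l,k}_{i,j;N}}$ almost surely for all $N,i,j,l$; 3. for every $N$ the sets $\{Y^{l,k}_{i,j;N}:l\in L\}$, $1\le i\le j\le N$, are independent; 4. $E(Y^{l,k}_{i,j;N}Y^{m,k}_{j,i;N})=\frac1N c_{l,m;k}$ for all $N,i,j,l,m$; 5. for all $m\in\mathbb N$ and $\chi:\{1,\dots,m\}\to L$ there are $M>0$ and $N_0\in\mathbb N$ such that for all $N>N_0$, all $1\le i\le j\le N$ and all choices $(\lambda(x),\tau(x))\in\{(i,j),(j,i)\}$, $x=1,\dots,m$, $$\Big|E\Big(\prod_{x=1}^mY^{\chi(x),k}_{\lambda(x),\tau(x);N}\Big)\Big|\le M N^{-m/2}.$$ Suppose moreover that: * for every $N$ the sets $\{Y^{l,k}_{i,j;N}:l\in L,k\in K\}$, $1\le i\le j\le N$, are independent; * for all $m\in\mathbb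 N$, $\chi:\{1,\dots,m\}\to L$ and $\epsilon:\{1,\dots,m\}\to K$ there are $M>0$ and $N_0\in\mathbb N$ such that for all $N>N_0$, $1\le i\le j\le N$ and $(\lambda(x),\tau(x))\in\{(i,j),(j,i)\}$, $$\Big|E\Big(\prod_{x=1}^mY^{\chi(x),\epsilon(x)}_{\lambda(x),\tau(x);N}\Big)\Big|\le M N^{-m/2};$$ * $E(Y^{l_1,k_1}_{i,j;N}Y^{l_2,k_2}_{j,i;N})=0$ for all $N$, $k_1\ne k_2$ in $K$, $l_1,l_2\in L$ and $1\le i,j\le N$. Let $D_{k',N}=\mathrm{diag}(d^{k'}_{1,N},\dots,d^{k'}_{N,N})$, $k'\in K'$, be constant complex diagonal matrices with $\sup_{N,\,1\le i\le N}|d^{k'}_{i,N}|<\infty$ for every $k'\in K'$, whose joint distribution with respect to $\frac1N\mathrm{Tr}$ converges, as $N\to\infty$, to that of a family $(d_{k'})_{k'\in K'}$ in a non-commutative probability space $(A,\varphi)$. Then the families $\{Y^{l,k}_N\}_{l\in L,k\in K}\cup\{D_{k',N}\}_{k'\in K'}$ converge jointly in distribution, with respect to $\frac1N E\circ\mathrm{Tr}$,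 to $\{s_{l,k}\}_{l\in L,k\in K}\cup\{d_{k'}\}_{k'\in K'}$, where for each $k$ the family $(s_{l,k})_{l\in L}=((s_{i,k})_{i\in I},(s_{j,k})_{j\in J})$ is semicircular of covariance $C_k$, and the families $(s_{l,k})_{l\in L}$, $k\in K$, together with the one further family $(d_{k'})_{k'\in K'}$, are free. Precisely: there is a non-commutative probability space with tracial functional that contains such semicircular families and a family with the same joint distribution as $(d_{k'})$, all of these being free; and the convergence holds to the joint distribution of any such realization, in any non-commutative probability space. -/

import Mathlib

open MeasureTheory ProbabilityTheory Filter Topology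

universe uI uJ uK uK' uΩ uA uB

namespace FreeProb

noncomputable section

/-! ### Non-commutative probability -/

/-- A functional `φ` is tracial. -/
def IsTracial {A : Type*} [Ring A] (φ : A → ℂ) : Prop :=
  ∀ a b : A, φ (a * b) = φ (b * a)

/-- The joint moment `φ (a_{g₁} a_{g₂} ⋯ a_{gₙ})` of the family `a` along the word
`w = [g₁, g₂, …, gₙ]`; the joint distribution of `a` is the collection of all of them. -/
def jointMoment {G A : Type*} [Ring A] (φ : A → ℂ) (a : G → A) (w : List G) : ℂ :=
  φ ((w.map a).prod)

/-- The families `a` in `(A, φ)` and `b` in `(B, ψ)` have the same joint distribution. -/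
def SameDistribution {G A B : Type*} [Ring A] [Ring B]
    (φ : A → ℂ) (a : G → A) (ψ : B → ℂ) (b : G → B) : Prop :=
  ∀ w : List G, jointMoment φ a w = jointMoment ψ b w

/-- Convergence in (joint) distribution of the families `a N` in `(A N, φ N)` to the family `b`
in `(B, ψ)`: every joint moment converges. -/
def ConvergesInDistribution {G : Type*} {A : ℕ → Type*} [∀ N, Ring (A N)] {B : Type*} [Ring B]
    (φ : ∀ N, A N → ℂ) (a : ∀ N, G → A N) (ψ : B → ℂ) (b : G → B) : Prop :=
  ∀ w : List G, Tendsto (fun N => jointMoment (φ N) (a N) w) atTop (𝓝 (jointMoment ψ b w))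

/-- Freeness of a family of unital subalgebras: `φ (a₁ ⋯ aₙ) = 0` whenever `n ≥ 1`, every `aⱼ` is a
centred element of the subalgebra with index `iⱼ`, and neighbouring indices are distinct.
The word `a₁ ⋯ aₙ` is given with its indices, as the list of the pairs `(iⱼ, aⱼ)`. -/
def IsFree {ι B : Type*} [Ring B] [Algebra ℂ B] (φ : B → ℂ) (S : ι → Subalgebra ℂ B) : Prop :=
  ∀ w : List (ι × B), w ≠ [] → w.IsChain (fun x y => x.1 ≠ y.1) →
    (∀ x ∈ w, x.2 ∈ S x.1 ∧ φ x.2 = 0) → φ ((w.map Prod.snd).prod) = 0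

/-- A non-crossing pairing of `{0, …, n-1}`, written as the fixed-point free involution that
exchanges the two elements of each block; there are no `p < q < π p < π q`. -/
def IsNCPairing {n : ℕ} (π : Equiv.Perm (Fin n)) : Prop :=
  (∀ p, π (π p) = p) ∧ (∀ p, π p ≠ p) ∧ ∀ p q, ¬ (p < q ∧ q < π p ∧ π p < π q)

instance {n : ℕ} : DecidablePred (IsNCPairing (n := n)) := fun π => by
  unfold IsNCPairing; infer_instance

/-- `s` is a (centred) semicircular family of covariance `c`:
`φ (s_{i₁} ⋯ s_{iₙ})` is the sum over the non-crossing pairings `π` of `{1, …, n}` of the products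
of the `c_{i_p, i_q}` over the blocks `{p < q}` of `π`. -/
def IsSemicircularFamily {L B : Type*} [Ring B] (φ : B → ℂ) (s : L → B) (c : Matrix L L ℝ) :
    Prop :=
  ∀ (n : ℕ) (i : Fin n → L),
    φ ((List.ofFn fun p => s (i p)).prod) =
      ∑ π : Equiv.Perm (Fin n) with IsNCPairing π,
        ∏ p : Fin n with p < π p, (c (i p) (i (π p)) : ℂ)

/-- The limit object: in `(B, ψ)` there are semicircular families `s k` of covariances `C k` and
a family `d'` distributed as the family `d` in `(A, φ)`, such that the families `s k`
together with the one further family `d'` (index `none`) are free. -/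
structure IsFreeLimit {K K' L A B : Type*} [Ring A] [Ring B] [Algebra ℂ B]
    (C : K → Matrix L L ℝ) (φ : A → ℂ) (d : K' → A)
    (ψ : B → ℂ) (s : K → L → B) (d' : K' → B) : Prop where
  semicircular : ∀ k, IsSemicircularFamily ψ (s k) (C k)
  sameDistribution : SameDistribution ψ d' φ d
  free : IsFree ψ (fun o : Option K =>
    o.elim (Algebra.adjoin ℂ (Set.range d')) (fun k => Algebra.adjoin ℂ (Set.range (s k))))

/-! ### Random matrices -/

/-- The normalized trace of an `N × N` matrix. -/
def normTrace {N : ℕ} (M : Matrix (Fin N) (Fin N) ℂ) : ℂ :=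
  (N : ℂ)⁻¹ * M.trace

/-- The expectation of the normalized trace of an `N × N` matrix of random variables. -/
def meanNormTrace {Ω : Type*} [MeasurableSpace Ω] (P : Measure Ω) {N : ℕ}
    (M : Matrix (Fin N) (Fin N) (Ω → ℂ)) : ℂ :=
  (N : ℂ)⁻¹ * ∑ i, ∫ ω, M i i ω ∂P

/-- A matrix of numbers, as a matrix of constant random variables. -/
def constMatrix (Ω : Type*) {N : ℕ} (M : Matrix (Fin N) (Fin N) ℂ) :
    Matrix (Fin N) (Fin N) (Ω → ℂ) :=
  M.map (fun z _ => z)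

/-- `X N`, for `N = 1, 2, …`, is a self-adjoint `C`-random family, indexed by `L`, of `N × N`
matrices with entries in `L^{∞-}`, the intersection of the spaces `L^p`, `1 ≤ p < ∞`. -/
structure IsSelfAdjointRandomFamily {L : Type*} {Ω : ℕ → Type*} [∀ N, MeasurableSpace (Ω N)]
    (P : ∀ N, Measure (Ω N)) (C : Matrix L L ℝ)
    (X : ∀ N, L → Matrix (Fin N) (Fin N) (Ω N → ℂ)) : Prop where
  memLp : ∀ N l i j (p : ENNReal), p ≠ ⊤ → MemLp (X N l i j) p (P N)
  mean_zero : ∀ N l i j, ∫ ω, X N l i j ω ∂(P N) = 0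
  selfAdjoint : ∀ N l i j, ∀ᵐ ω ∂(P N), X N l j i ω = star (X N l i j ω)
  indep : ∀ N, iIndepFun
    (fun (e : {e : Fin N × Fin N // e.1 ≤ e.2}) (ω : Ω N) (l : L) => X N l e.1.1 e.1.2 ω) (P N)
  covariance : ∀ N l₁ l₂ i j,
    ∫ ω, X N l₁ i j ω * X N l₂ j i ω ∂(P N) = (C l₁ l₂ : ℂ) / N
  moment_bound : ∀ (m : ℕ) (χ : Fin m → L), ∃ M : ℝ, 0 < M ∧ ∃ N₀ : ℕ, ∀ N > N₀,
    ∀ i j : Fin N, i ≤ j → ∀ r t : Fin m → Fin N,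
      (∀ x, (r x = i ∧ t x = j) ∨ (r x = j ∧ t x = i)) →
      ‖∫ ω, ∏ x, X N (χ x) (r x) (t x) ω ∂(P N)‖ ≤ M * (N : ℝ) ^ (-(m : ℝ) / 2)

/-- The joint conditions on the random families `Y N k`, `k ∈ K`: joint independence of the sets of
entries in different positions, joint moment bounds, and uncorrelatedness for different `k`. -/
structure JointConditions {K L : Type*} {Ω : ℕ → Type*} [∀ N, MeasurableSpace (Ω N)]
    (P : ∀ N, Measure (Ω N)) (Y : ∀ N, K → L → Matrix (Fin N) (Fin N) (Ω N → ℂ)) : Prop where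
  indep : ∀ N, iIndepFun
    (fun (e : {e : Fin N × Fin N // e.1 ≤ e.2}) (ω : Ω N) (q : K × L) =>
      Y N q.1 q.2 e.1.1 e.1.2 ω) (P N)
  moment_bound : ∀ (m : ℕ) (χ : Fin m → L) (ε : Fin m → K), ∃ M : ℝ, 0 < M ∧ ∃ N₀ : ℕ, ∀ N > N₀,
    ∀ i j : Fin N, i ≤ j → ∀ r t : Fin m → Fin N,
      (∀ x, (r x = i ∧ t x = j) ∨ (r x = j ∧ t x = i)) →
      ‖∫ ω, ∏ x, Y N (ε x) (χ x) (r x) (t x) ω ∂(P N)‖ ≤ M * (N : ℝ) ^ (-(m : ℝ) / 2)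
  uncorrelated : ∀ N k₁ k₂ l₁ l₂ i j, k₁ ≠ k₂ →
    ∫ ω, Y N k₁ l₁ i j ω * Y N k₂ l₂ j i ω ∂(P N) = 0

end

end FreeProb

namespace FreeProb

/-- Non-crossing pairings of the interval `[a, b)` in `{0, …, n-1}`, written as involutions
that fix exactly the points outside of the interval. -/
def IsNCPairingOn {n : ℕ} (a b : ℕ) (g : Fin n → Fin n) : Prop :=
  (∀ p, g (g p) = p) ∧ (∀ p, g p = p ↔ ¬ (a ≤ p.1 ∧ p.1 < b)) ∧
    ∀ p q, ¬ (p < q ∧ q < g p ∧ g p < g q)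

open Classical in
/-- The sum over the non-crossing pairings of `[a, b)` of the products of the values of `c`
on the blocks. -/
noncomputable def ncSum {n : ℕ} (c : Fin n → Fin n → ℂ) (a b : ℕ) : ℂ :=
  ∑ g : Fin n → Fin n with IsNCPairingOn a b g, ∏ p, if p < g p then c p (g p) else 1

theorem sum_isNCPairing {n : ℕ} (c : Fin n → Fin n → ℂ) :
    ∑ π : Equiv.Perm (Fin n) with IsNCPairing π, ∏ p : Fin n with p < π p, c p (π p) =
      ncSum c 0 n := by
  classical
  unfold ncSum
  refine Finset.sum_bij (fun π _ => (π : Fin n → Fin n)) ?_ ?_ ?_ ?_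
  · intro π hπ
    simp only [Finset.mem_filter, Finset.mem_univ, true_and] at hπ ⊢
    refine ⟨hπ.1, fun p => ?_, hπ.2.2⟩
    simp [hπ.2.1 p]
  · intro π _ π' _ h
    exact DFunLike.coe_injective h
  · intro g hg
    simp only [Finset.mem_filter, Finset.mem_univ, true_and] at hg
    refine ⟨Function.Involutive.toPerm g hg.1, ?_, rfl⟩
    simp only [Finset.mem_filter, Finset.mem_univ, true_and]
    refine ⟨hg.1, fun p hp => ?_, hg.2.2⟩
    exact (hg.2.1 p).1 hp ⟨Nat.zero_le _, p.2⟩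
  · intro π _
    rw [Finset.prod_filter]

theorem ncSum_of_le {n : ℕ} (c : Fin n → Fin n → ℂ) {a b : ℕ} (h : b ≤ a) : ncSum c a b = 1 := by
  classical
  unfold ncSum
  have : (Finset.univ.filter fun g : Fin n → Fin n => IsNCPairingOn a b g) = {id} := by
    ext g
    simp only [Finset.mem_filter, Finset.mem_univ, true_and, Finset.mem_singleton]
    constructor
    · intro hg
      funext p
      exact (hg.2.1 p).2 (by omega)
    · rintro rfl
      refine ⟨fun p => rfl, fun p => ?_, fun p q h => ?_⟩
      · simp only [id, true_iff]; omega
      · simp only [id] at h; omega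
  rw [this, Finset.sum_singleton]
  simp

/-- The pairing of `[a, b)` composed of the block `{a, j}` and of pairings of `(a, j)` and
`(j, b)`. -/
def joinPairing {n : ℕ} (a j : Fin n) (σ τ : Fin n → Fin n) (x : Fin n) : Fin n :=
  if x = a then j else if x = j then a else if a < x ∧ x < j then σ x else τ x

/-- The restriction of a map to an interval, continued by the identity. -/
def restrictPairing {n : ℕ} (l r : ℕ) (g : Fin n → Fin n) (x : Fin n) : Fin n :=
  if l ≤ x.1 ∧ x.1 < r then g x else x

theorem IsNCPairingOn.mem {n a b : ℕ} {g : Fin n → Fin n} (hg : IsNCPairingOn a b g) {p : Fin n}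
    (hp : a ≤ p.1 ∧ p.1 < b) : a ≤ (g p).1 ∧ (g p).1 < b := by
  by_contra h
  have h1 := (hg.2.1 (g p)).2 h
  rw [hg.1 p] at h1
  exact (hg.2.1 p).1 h1.symm hp

theorem IsNCPairingOn.eq_self {n a b : ℕ} {g : Fin n → Fin n} (hg : IsNCPairingOn a b g)
    {p : Fin n} (hp : ¬ (a ≤ p.1 ∧ p.1 < b)) : g p = p := (hg.2.1 p).2 hp

theorem IsNCPairingOn.partner {n b : ℕ} {a : Fin n} {g : Fin n → Fin n}
    (hg : IsNCPairingOn a b g) (hab : a.1 < b) : a < g a ∧ (g a).1 < b := by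
  have h1 := hg.mem (p := a) ⟨le_rfl, hab⟩
  have h2 : g a ≠ a := fun h => (hg.2.1 a).1 h ⟨le_rfl, hab⟩
  exact ⟨lt_of_le_of_ne h1.1 h2.symm, h1.2⟩

theorem IsNCPairingOn.inside {n b : ℕ} {a : Fin n} {g : Fin n → Fin n}
    (hg : IsNCPairingOn a b g) (hab : a.1 < b) {x : Fin n} (h1 : a < x) (h2 : x < g a) :
    a < g x ∧ g x < g a := by
  have hj := hg.partner hab
  have hx := hg.mem (p := x) ⟨by omega, by omega⟩
  have h3 := hg.2.2 a x
  have h4 : g x ≠ g a := fun h => by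
    have := congrArg g h
    rw [hg.1, hg.1] at this
    omega
  have h5 : g x ≠ a := fun h => by
    have := congrArg g h
    rw [hg.1] at this
    omega
  omega

theorem IsNCPairingOn.outside {n b : ℕ} {a : Fin n} {g : Fin n → Fin n}
    (hg : IsNCPairingOn a b g) (hab : a.1 < b) {x : Fin n} (h1 : g a < x) (h2 : x.1 < b) :
    g a < g x ∧ (g x).1 < b := by
  have hj := hg.partner hab
  have hx := hg.mem (p := x) ⟨by omega, by omega⟩
  have h4 : g x ≠ g a := fun h => by
    have := congrArg g h
    rw [hg.1, hg.1] at this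
    omega
  have h5 : g x ≠ a := fun h => by
    have := congrArg g h
    rw [hg.1] at this
    omega
  refine ⟨?_, hx.2⟩
  by_contra h
  have := hg.inside hab (x := g x) (by omega) (by omega)
  rw [hg.1] at this
  omega

theorem joinPairing_isNCPairingOn {n b : ℕ} {a j : Fin n} {σ τ : Fin n → Fin n} (haj : a < j)
    (hjb : j.1 < b) (hσ : IsNCPairingOn (a.1 + 1) j σ) (hτ : IsNCPairingOn (j.1 + 1) b τ) :
    IsNCPairingOn a b (joinPairing a j σ τ) := by
  have cl : ∀ x : Fin n, (x = a ∧ joinPairing a j σ τ x = j) ∨ (x = j ∧ joinPairing a j σ τ x = a) ∨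
      ((a < x ∧ x < j) ∧ (a < σ x ∧ σ x < j) ∧ joinPairing a j σ τ x = σ x) ∨
      ((j < x ∧ x.1 < b) ∧ (j < τ x ∧ (τ x).1 < b) ∧ joinPairing a j σ τ x = τ x) ∨
      ((x < a ∨ b ≤ x.1) ∧ joinPairing a j σ τ x = x) := by
    intro x
    unfold joinPairing
    by_cases h1 : x = a
    · simp [h1]
    by_cases h2 : x = j
    · rw [if_neg h1, if_pos h2]; simp [h2]
    rw [if_neg h1, if_neg h2]
    by_cases h3 : a < x ∧ x < j
    · have := hσ.mem (p := x) (by omega)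
      rw [if_pos h3]
      refine Or.inr (Or.inr (Or.inl ⟨h3, by omega, rfl⟩))
    · rw [if_neg h3]
      by_cases h4 : j < x ∧ x.1 < b
      · have := hτ.mem (p := x) (by omega)
        exact Or.inr (Or.inr (Or.inr (Or.inl ⟨h4, by omega, rfl⟩)))
      · exact Or.inr (Or.inr (Or.inr (Or.inr ⟨by omega, hτ.eq_self (by omega)⟩)))
  refine ⟨fun x => ?_, fun x => ?_, fun p q => ?_⟩
  · have h1 := cl x
    have h2 := cl (joinPairing a j σ τ x)
    have h3 := hσ.1 x
    have h4 := hτ.1 x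
    rcases h1 with h | h | h | h | h
    · rw [h.2] at h2 ⊢; omega
    · rw [h.2] at h2 ⊢; omega
    · rw [h.2.2] at h2 ⊢; rw [h3] at h2; omega
    · rw [h.2.2] at h2 ⊢; rw [h4] at h2; omega
    · rw [h.2, h.2]
  · have h1 := cl x
    have h3 := hσ.2.1 x
    have h4 := hτ.2.1 x
    omega
  · have h1 := cl p
    have h2 := cl q
    have h3 := hσ.2.2 p q
    have h4 := hτ.2.2 p q
    omega

theorem IsNCPairingOn.restrict_inside {n b : ℕ} {a : Fin n} {g : Fin n → Fin n}
    (hg : IsNCPairingOn a b g) (hab : a.1 < b) :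
    IsNCPairingOn (a.1 + 1) (g a) (restrictPairing (a.1 + 1) (g a) g) := by
  have cl : ∀ x : Fin n, ((a < x ∧ x < g a) ∧ (a < g x ∧ g x < g a) ∧
      restrictPairing (a.1 + 1) (g a) g x = g x) ∨
      (¬ (a < x ∧ x < g a) ∧ restrictPairing (a.1 + 1) (g a) g x = x) := by
    intro x
    unfold restrictPairing
    split_ifs with h
    · exact Or.inl ⟨by omega, hg.inside hab (by omega) (by omega), rfl⟩
    · exact Or.inr ⟨by omega, rfl⟩
  have hj := hg.partner hab
  refine ⟨fun x => ?_, fun x => ?_, fun p q => ?_⟩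
  · have h1 := cl x
    have h2 := cl (restrictPairing (a.1 + 1) (g a) g x)
    have h3 := hg.1 x
    rcases h1 with h | h
    · rw [h.2.2] at h2 ⊢; rw [h3] at h2; omega
    · rw [h.2, h.2]
  · have h1 := cl x
    have h3 := hg.2.1 x
    omega
  · have h1 := cl p
    have h2 := cl q
    have h3 := hg.2.2 p q
    omega

theorem IsNCPairingOn.restrict_outside {n b : ℕ} {a : Fin n} {g : Fin n → Fin n}
    (hg : IsNCPairingOn a b g) (hab : a.1 < b) :
    IsNCPairingOn ((g a).1 + 1) b (restrictPairing ((g a).1 + 1) b g) := by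
  have cl : ∀ x : Fin n, ((g a < x ∧ x.1 < b) ∧ (g a < g x ∧ (g x).1 < b) ∧
      restrictPairing ((g a).1 + 1) b g x = g x) ∨
      (¬ (g a < x ∧ x.1 < b) ∧ restrictPairing ((g a).1 + 1) b g x = x) := by
    intro x
    unfold restrictPairing
    split_ifs with h
    · exact Or.inl ⟨by omega, hg.outside hab (by omega) (by omega), rfl⟩
    · exact Or.inr ⟨by omega, rfl⟩
  have hj := hg.partner hab
  refine ⟨fun x => ?_, fun x => ?_, fun p q => ?_⟩
  · have h1 := cl x
    have h2 := cl (restrictPairing ((g a).1 + 1) b g x)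
    have h3 := hg.1 x
    rcases h1 with h | h
    · rw [h.2.2] at h2 ⊢; rw [h3] at h2; omega
    · rw [h.2, h.2]
  · have h1 := cl x
    have h3 := hg.2.1 x
    omega
  · have h1 := cl p
    have h2 := cl q
    have h3 := hg.2.2 p q
    omega

theorem prod_joinPairing {n b : ℕ} (c : Fin n → Fin n → ℂ) {a j : Fin n} {σ τ : Fin n → Fin n}
    (haj : a < j) (hσ : IsNCPairingOn (a.1 + 1) j σ) (hτ : IsNCPairingOn (j.1 + 1) b τ) :
    (∏ p, if p < joinPairing a j σ τ p then c p (joinPairing a j σ τ p) else 1) =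
      c a j * (∏ p, if p < σ p then c p (σ p) else 1) * ∏ p, if p < τ p then c p (τ p) else 1 := by
  have h : ∀ p, (if p < joinPairing a j σ τ p then c p (joinPairing a j σ τ p) else 1) =
      (if p = a then c a j else 1) * (if p < σ p then c p (σ p) else 1) *
        (if p < τ p then c p (τ p) else 1) := by
    intro p
    unfold joinPairing
    by_cases h1 : p = a
    · subst h1
      simp [haj, hσ.eq_self (p := p) (by omega), hτ.eq_self (p := p) (by omega)]
    by_cases h2 : p = j
    · subst h2
      have : ¬ p < a := by omega
      simp [h1, hσ.eq_self (p := p) (by omega), hτ.eq_self (p := p) (by omega), this]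
    by_cases h3 : a < p ∧ p < j
    · simp only [if_neg h1, if_neg h2, if_pos h3]
      simp [hτ.eq_self (p := p) (by omega)]
    · simp only [if_neg h1, if_neg h2, if_neg h3]
      simp [hσ.eq_self (p := p) (by omega)]
  simp_rw [h, Finset.prod_mul_distrib]
  simp

theorem IsNCPairingOn.join_restrict {n b : ℕ} {a : Fin n} {g : Fin n → Fin n}
    (hg : IsNCPairingOn a b g) (hab : a.1 < b) :
    joinPairing a (g a) (restrictPairing (a.1 + 1) (g a) g)
      (restrictPairing ((g a).1 + 1) b g) = g := by
  funext x
  have hj := hg.partner hab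
  unfold joinPairing restrictPairing
  split_ifs with h1 h2 h3 h4 h5
  · rw [h1]
  · rw [h2, hg.1]
  · rfl
  · omega
  · rfl
  · exact (hg.eq_self (by omega)).symm

theorem ncSum_recursion {n : ℕ} (c : Fin n → Fin n → ℂ) (a : Fin n) (b : ℕ) (hab : a.1 < b) :
    ncSum c a b = ∑ j : Fin n,
      if a < j ∧ j.1 < b then c a j * ncSum c (a.1 + 1) j * ncSum c (j.1 + 1) b else 0 := by
  classical
  rw [← Finset.sum_filter]
  have : ∀ j : Fin n, c a j * ncSum c (a.1 + 1) j * ncSum c (j.1 + 1) b =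
      ∑ x ∈ (Finset.univ.filter fun g : Fin n → Fin n => IsNCPairingOn (a.1 + 1) j g) ×ˢ
        (Finset.univ.filter fun g : Fin n → Fin n => IsNCPairingOn (j.1 + 1) b g),
        c a j * (∏ p, if p < x.1 p then c p (x.1 p) else 1) *
          ∏ p, if p < x.2 p then c p (x.2 p) else 1 := by
    intro j
    unfold ncSum
    rw [mul_assoc, Finset.sum_mul_sum, ← Finset.sum_product', Finset.mul_sum]
    simp_rw [mul_assoc]
  simp_rw [this]
  rw [Finset.sum_sigma', ncSum]
  refine Finset.sum_bij' (fun g _ => ⟨g a, restrictPairing (a.1 + 1) (g a) g,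
    restrictPairing ((g a).1 + 1) b g⟩) (fun x _ => joinPairing a x.1 x.2.1 x.2.2) ?_ ?_ ?_ ?_ ?_
  · intro g hg
    simp only [Finset.mem_filter, Finset.mem_univ, true_and, Finset.mem_sigma,
      Finset.mem_product] at hg ⊢
    exact ⟨hg.partner hab, hg.restrict_inside hab, hg.restrict_outside hab⟩
  · rintro ⟨j, σ, τ⟩ h
    simp only [Finset.mem_filter, Finset.mem_univ, true_and, Finset.mem_sigma,
      Finset.mem_product] at h ⊢
    exact joinPairing_isNCPairingOn h.1.1 h.1.2 h.2.1 h.2.2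
  · intro g hg
    simp only [Finset.mem_filter, Finset.mem_univ, true_and] at hg
    exact hg.join_restrict hab
  · rintro ⟨j, σ, τ⟩ h
    simp only [Finset.mem_filter, Finset.mem_univ, true_and, Finset.mem_sigma,
      Finset.mem_product] at h
    have hja : joinPairing a j σ τ a = j := by simp [joinPairing]
    simp only [hja]
    congr 2
    · funext x
      unfold restrictPairing joinPairing
      split_ifs with h1 h2 h3 h4
      · omega
      · omega
      · rfl
      · omega
      · exact (h.2.1.eq_self h1).symm
    · funext x
      unfold restrictPairing joinPairing
      split_ifs with h1 h2 h3 h4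
      · omega
      · omega
      · omega
      · rfl
      · exact (h.2.2.eq_self h1).symm
  · intro g hg
    simp only [Finset.mem_filter, Finset.mem_univ, true_and] at hg
    have := prod_joinPairing c (hg.partner hab).1 (hg.restrict_inside hab)
      (hg.restrict_outside hab)
    rw [hg.join_restrict hab] at this
    exact this

section SplitSum
variable {X M : Type*}

/-- The sum of `g u b v` over all decompositions `w = u ++ b :: v`. -/
def splitSum [AddCommMonoid M] : List X → (List X → X → List X → M) → M
  | [], _ => 0
  | b :: w, g => g [] b w + splitSum w (fun u c v => g (b :: u) c v)

theorem splitSum_congr [AddCommMonoid M] {w : List X} {g h : List X → X → List X → M}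
    (H : ∀ u b v, w = u ++ b :: v → g u b v = h u b v) : splitSum w g = splitSum w h := by
  induction w generalizing g h with
  | nil => rfl
  | cons b w ih =>
    simp only [splitSum]
    rw [H [] b w rfl, ih fun u c v e => H (b :: u) c v (by rw [e]; rfl)]

theorem splitSum_zero [AddCommMonoid M] (w : List X) :
    splitSum w (fun _ _ _ => (0 : M)) = 0 := by
  induction w with
  | nil => rfl
  | cons b w ih => simp only [splitSum, ih, add_zero]

theorem splitSum_eq_zero [AddCommMonoid M] {w : List X} {g : List X → X → List X → M}
    (H : ∀ u b v, w = u ++ b :: v → g u b v = 0) : splitSum w g = 0 := by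
  rw [splitSum_congr H, splitSum_zero]

theorem splitSum_append [AddCommMonoid M] (w₁ w₂ : List X) (g : List X → X → List X → M) :
    splitSum (w₁ ++ w₂) g = splitSum w₁ (fun u b v => g u b (v ++ w₂)) +
      splitSum w₂ (fun u b v => g (w₁ ++ u) b v) := by
  induction w₁ generalizing g with
  | nil => simp [splitSum]
  | cons b w ih => simp only [List.cons_append, splitSum, ih, add_assoc]

theorem splitSum_finset_sum [AddCommMonoid M] {κ : Type*} (s : Finset κ) (w : List X)
    (g : κ → List X → X → List X → M) :
    splitSum w (fun u b v => ∑ k ∈ s, g k u b v) = ∑ k ∈ s, splitSum w (g k) := by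
  induction w generalizing g with
  | nil => simp [splitSum]
  | cons b w ih => simp only [splitSum, ih, Finset.sum_add_distrib]

theorem splitSum_map [AddCommMonoid M] {M' : Type*} [AddCommMonoid M'] (F : M →+ M') (w : List X)
    (g : List X → X → List X → M) :
    F (splitSum w g) = splitSum w (fun u b v => F (g u b v)) := by
  induction w generalizing g with
  | nil => simp [splitSum]
  | cons b w ih => simp only [splitSum, map_add, ih]

theorem splitSum_mul_left [NonUnitalNonAssocSemiring M] (z : M) (w : List X)
    (g : List X → X → List X → M) :
    z * splitSum w g = splitSum w (fun u b v => z * g u b v) :=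
  splitSum_map (AddMonoidHom.mulLeft z) w g

theorem norm_splitSum_le [SeminormedAddCommGroup M] {w : List X} {g : List X → X → List X → M}
    {κ : ℝ} (H : ∀ u b v, w = u ++ b :: v → ‖g u b v‖ ≤ κ) :
    ‖splitSum w g‖ ≤ w.length * κ := by
  induction w generalizing g with
  | nil => simp [splitSum]
  | cons b w ih =>
    simp only [splitSum, List.length_cons, Nat.cast_add, Nat.cast_one]
    have h1 := H [] b w rfl
    have h2 := ih (g := fun u c v => g (b :: u) c v)
      fun u c v e => H (b :: u) c v (by rw [e]; rfl)
    have h3 := norm_add_le (g [] b w) (splitSum w fun u c v => g (b :: u) c v)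
    linarith

theorem tendsto_splitSum [AddCommMonoid M] [TopologicalSpace M] [ContinuousAdd M] {α : Type*}
    {l : Filter α} {w : List X} {g : α → List X → X → List X → M} {g' : List X → X → List X → M}
    (H : ∀ u b v, w = u ++ b :: v → Tendsto (fun n => g n u b v) l (𝓝 (g' u b v))) :
    Tendsto (fun n => splitSum w (g n)) l (𝓝 (splitSum w g')) := by
  induction w generalizing g g' with
  | nil => exact tendsto_const_nhds
  | cons b w ih =>
    exact (H [] b w rfl).add (ih fun u c v e => H (b :: u) c v (by rw [e]; rfl))

end SplitSum

section Walks
variable {Q K' ι : Type*}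

/-- `S` is a walk from `i` to `j`, given as the list of its labelled steps. -/
def IsWalk : List (Q × ι × ι) → ι → ι → Prop
  | [], i, j => i = j
  | t :: S, i, j => t.2.1 = i ∧ IsWalk S t.2.2 j

theorem isWalk_append {S₁ S₂ : List (Q × ι × ι)} {i j : ι} :
    IsWalk (S₁ ++ S₂) i j ↔ ∃ k, IsWalk S₁ i k ∧ IsWalk S₂ k j := by
  induction S₁ generalizing i with
  | nil => simp [IsWalk]
  | cons t S ih => simp [IsWalk, ih, and_assoc]

/-- The letters of a word of the first kind. -/
def leftLetters (w : List (Q ⊕ K')) : List Q := w.filterMap Sum.getLeft?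

@[simp] theorem leftLetters_nil : leftLetters ([] : List (Q ⊕ K')) = [] := rfl

@[simp] theorem leftLetters_inl (q : Q) (w : List (Q ⊕ K')) :
    leftLetters (Sum.inl q :: w) = q :: leftLetters w := rfl

@[simp] theorem leftLetters_inr (k : K') (w : List (Q ⊕ K')) :
    leftLetters (Sum.inr k :: w) = leftLetters w := rfl

/-- The vertices that the steps of a walk lead to. -/
def targets [DecidableEq ι] (S : List (Q × ι × ι)) : Finset ι := (S.map fun t => t.2.2).toFinset

@[simp] theorem targets_nil [DecidableEq ι] : targets ([] : List (Q × ι × ι)) = ∅ := rfl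

@[simp] theorem targets_cons [DecidableEq ι] (t : Q × ι × ι) (S : List (Q × ι × ι)) :
    targets (t :: S) = insert t.2.2 (targets S) := by simp [targets]

theorem targets_append [DecidableEq ι] (S T : List (Q × ι × ι)) : targets (S ++ T) = targets S ∪ targets T := by
  simp [targets]

variable [Fintype ι] [DecidableEq ι]

/-- The sum of `f S` over all walks `S` from `i` to `j` whose steps are labelled by the letters of
the first kind of `w`; each letter `k` of the second kind contributes the weight `δ k`, at the
vertex where the walk is. -/
noncomputable def walkSum (δ : K' → ι → ℂ) :
    List (Q ⊕ K') → ι → ι → (List (Q × ι × ι) → ℂ) → ℂ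
  | [], i, j, f => if i = j then f [] else 0
  | Sum.inl q :: w, i, j, f => ∑ k, walkSum δ w k j (fun S => f ((q, i, k) :: S))
  | Sum.inr k :: w, i, j, f => δ k i * walkSum δ w i j f

variable (δ : K' → ι → ℂ)

theorem walkSum_congr {w : List (Q ⊕ K')} {i j : ι} {f g : List (Q × ι × ι) → ℂ}
    (H : ∀ S, IsWalk S i j → S.map Prod.fst = leftLetters w → f S = g S) :
    walkSum δ w i j f = walkSum δ w i j g := by
  induction w generalizing i f g with
  | nil =>
    simp only [walkSum]
    split_ifs with h
    · exact H [] h rfl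
    · rfl
  | cons x w ih =>
    rcases x with q | k
    · simp only [walkSum]
      refine Finset.sum_congr rfl fun k _ => ih fun S hS hl => H _ ⟨rfl, hS⟩ ?_
      simp [hl]
    · simp only [walkSum]
      rw [ih fun S hS hl => H S hS hl]

theorem walkSum_add (w : List (Q ⊕ K')) (i j : ι) (f g : List (Q × ι × ι) → ℂ) :
    walkSum δ w i j (fun S => f S + g S) = walkSum δ w i j f + walkSum δ w i j g := by
  induction w generalizing i f g with
  | nil => simp only [walkSum]; split_ifs <;> simp
  | cons x w ih =>
    rcases x with q | k
    · simp only [walkSum, ih, Finset.sum_add_distrib]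
    · simp only [walkSum, ih, mul_add]

theorem walkSum_mul_left (w : List (Q ⊕ K')) (i j : ι) (z : ℂ) (f : List (Q × ι × ι) → ℂ) :
    walkSum δ w i j (fun S => z * f S) = z * walkSum δ w i j f := by
  induction w generalizing i f with
  | nil => simp only [walkSum]; split_ifs <;> simp
  | cons x w ih =>
    rcases x with q | k
    · simp only [walkSum, ih, Finset.mul_sum]
    · simp only [walkSum, ih]; ring

theorem walkSum_sub (w : List (Q ⊕ K')) (i j : ι) (f g : List (Q × ι × ι) → ℂ) :
    walkSum δ w i j (fun S => f S - g S) = walkSum δ w i j f - walkSum δ w i j g := by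
  have h1 := walkSum_add δ w i j f (fun S => -1 * g S)
  have h2 := walkSum_mul_left δ w i j (-1) g
  simp only [sub_eq_add_neg]
  rw [show (fun S => f S + -g S) = fun S => f S + -1 * g S from by funext S; ring, h1, h2]
  ring

theorem walkSum_zero (w : List (Q ⊕ K')) (i j : ι) :
    walkSum δ w i j (fun _ => 0) = 0 := by
  simpa using walkSum_mul_left δ w i j 0 (fun _ => 0)

theorem walkSum_map_inr_append (l : List K') (w : List (Q ⊕ K')) (i j : ι)
    (f : List (Q × ι × ι) → ℂ) :
    walkSum δ (l.map Sum.inr ++ w) i j f = (l.map (δ · i)).prod * walkSum δ w i j f := by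
  induction l with
  | nil => simp
  | cons k l ih =>
    simp only [List.map_cons, List.cons_append, walkSum, ih, List.prod_cons, mul_assoc]

theorem walkSum_splitSum (w : List (Q ⊕ K')) (i j : ι)
    (g : List (Q × ι × ι) → Q × ι × ι → List (Q × ι × ι) → ℂ) :
    walkSum δ w i j (fun S => splitSum S g) = splitSum w (fun u b v =>
      Sum.elim (fun q => ∑ p, ∑ r, walkSum δ u i p (fun S₁ => walkSum δ v r j
        (fun S₂ => g S₁ (q, p, r) S₂))) (fun _ => 0) b) := by
  induction w generalizing i g with
  | nil => simp [walkSum, splitSum]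
  | cons x w ih =>
    rcases x with q | k
    · simp only [walkSum, splitSum, walkSum_add, ih, Finset.sum_add_distrib, Sum.elim_inl]
      congr 1
      · rw [Finset.sum_comm]
        simp
      · rw [← splitSum_finset_sum]
        refine splitSum_congr fun u b v _ => ?_
        rcases b with q' | k'
        · simp only [Sum.elim_inl]
          rw [Finset.sum_comm]
          refine Finset.sum_congr rfl fun p _ => ?_
          rw [Finset.sum_comm]
        · simp
    · simp only [walkSum, splitSum, ih, Sum.elim_inr, zero_add, splitSum_mul_left]
      refine splitSum_congr fun u b v _ => ?_
      rcases b with q' | k'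
      · simp only [Sum.elim_inl, Finset.mul_sum]
      · simp

theorem list_prod_apply_eq_walkSum {Ω : Type*} (Y : Q → Matrix ι ι (Ω → ℂ))
    (w : List (Q ⊕ K')) (i j : ι) (ω : Ω) :
    (w.map (Sum.elim Y fun k => (Matrix.diagonal (δ k)).map fun z _ => z)).prod i j ω =
      walkSum δ w i j (fun S => (S.map fun t => Y t.1 t.2.1 t.2.2 ω).prod) := by
  induction w generalizing i with
  | nil => simp only [List.map_nil, List.prod_nil, Matrix.one_apply, walkSum]; split_ifs <;> rfl
  | cons x w ih =>
    simp only [List.map_cons, List.prod_cons, Matrix.mul_apply, Finset.sum_apply, Pi.mul_apply, ih]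
    rcases x with q | k
    · simp only [walkSum, Sum.elim_inl, List.map_cons, List.prod_cons, walkSum_mul_left]
    · simp [walkSum, Matrix.diagonal_apply]

theorem integral_walkSum {Ω : Type*} [MeasurableSpace Ω] (P : Measure Ω)
    (w : List (Q ⊕ K')) (i j : ι) (f : List (Q × ι × ι) → Ω → ℂ) (hf : ∀ S, Integrable (f S) P) :
    Integrable (fun ω => walkSum δ w i j (fun S => f S ω)) P ∧
    ∫ ω, walkSum δ w i j (fun S => f S ω) ∂P = walkSum δ w i j (fun S => ∫ ω, f S ω ∂P) := by
  induction w generalizing i f with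
  | nil =>
    simp only [walkSum]
    split_ifs
    · exact ⟨hf [], rfl⟩
    · simp
  | cons x w ih =>
    rcases x with q | k
    · simp only [walkSum]
      have h := fun k => ih k (fun S => f ((q, i, k) :: S)) fun S => hf _
      refine ⟨integrable_finsetSum _ fun k _ => (h k).1, ?_⟩
      rw [integral_finsetSum _ fun k _ => (h k).1]
      exact Finset.sum_congr rfl fun k _ => (h k).2
    · simp only [walkSum]
      have h := ih i f hf
      exact ⟨h.1.const_mul _, by rw [integral_const_mul, h.2]⟩

/-- Walks with at most `v` vertices are few. -/
theorem norm_walkSum_le {w : List (Q ⊕ K')} {i j : ι} {f : List (Q × ι × ι) → ℂ} {A : Finset ι}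
    {κ D : ℝ} {v : ℕ} (hi : i ∈ A) (hA : A.card ≤ v) (hκ : 0 ≤ κ) (hD : 1 ≤ D)
    (hδ : ∀ k i, Sum.inr k ∈ w → ‖δ k i‖ ≤ D)
    (hf : ∀ S, IsWalk S i j → S.map Prod.fst = leftLetters w →
      if (A ∪ targets S).card ≤ v then ‖f S‖ ≤ κ else f S = 0) :
    ‖walkSum δ w i j f‖ ≤ κ * (D * (v + 1)) ^ w.length * (Fintype.card ι : ℝ) ^ (v - A.card) := by
  induction w generalizing i f A with
  | nil =>
    have hN : 0 < Fintype.card ι := Fintype.card_pos_iff.2 ⟨i⟩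
    have hN' : (1 : ℝ) ≤ Fintype.card ι := by exact_mod_cast hN
    have hone : (1 : ℝ) ≤ (Fintype.card ι : ℝ) ^ (v - A.card) := one_le_pow₀ hN'
    simp only [walkSum, List.length_nil, pow_zero, mul_one]
    split_ifs with h
    · have := hf [] h rfl
      simp only [targets_nil, Finset.union_empty, if_pos hA] at this
      nlinarith
    · simp; positivity
  | cons x w ih =>
    have hN : 0 < Fintype.card ι := Fintype.card_pos_iff.2 ⟨i⟩
    have hN' : (1 : ℝ) ≤ Fintype.card ι := by exact_mod_cast hN
    rcases x with q | k
    · simp only [walkSum]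
      set B : ℝ := κ * (D * (v + 1)) ^ w.length * (Fintype.card ι : ℝ) ^ (v - A.card) with hB
      have hB0 : 0 ≤ B := by positivity
      have hin : ∀ k ∈ A, ‖walkSum δ w k j (fun S => f ((q, i, k) :: S))‖ ≤ B := by
        intro k hk
        refine ih hk hA (fun k i h => hδ k i (List.mem_cons_of_mem _ h)) fun S hS hl => ?_
        have := hf ((q, i, k) :: S) ⟨rfl, hS⟩ (by simp [hl])
        rwa [targets_cons, Finset.union_insert,
          Finset.insert_eq_of_mem (Finset.mem_union_left _ hk)] at this
      have hout : ∀ k ∈ Aᶜ, (Fintype.card ι : ℝ) *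
          ‖walkSum δ w k j (fun S => f ((q, i, k) :: S))‖ ≤ B := by
        intro k hk
        rw [Finset.mem_compl] at hk
        have hcard : (insert k A).card = A.card + 1 := Finset.card_insert_of_notMem hk
        have hset : ∀ S : List (Q × ι × ι),
            insert k A ∪ targets S = A ∪ targets ((q, i, k) :: S) := by
          intro S
          rw [targets_cons, Finset.union_insert, Finset.insert_union]
        rcases Nat.lt_or_ge A.card v with hlt | hge
        · have := ih (i := k) (f := fun S => f ((q, i, k) :: S)) (A := insert k A)
            (Finset.mem_insert_self _ _) (by omega)
            (fun k i h => hδ k i (List.mem_cons_of_mem _ h)) fun S hS hl => by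
              rw [hset]
              exact hf ((q, i, k) :: S) ⟨rfl, hS⟩ (by simp [hl])
          rw [hcard] at this
          calc _ ≤ (Fintype.card ι : ℝ) * _ := mul_le_mul_of_nonneg_left this (by positivity)
            _ = B := by
              rw [hB, show v - A.card = (v - (A.card + 1)) + 1 by omega, pow_succ]; ring
        · have h0 : walkSum δ w k j (fun S => f ((q, i, k) :: S)) = 0 := by
            rw [walkSum_congr δ (g := fun _ => 0), walkSum_zero]
            intro S hS hl
            have h1 := hf ((q, i, k) :: S) ⟨rfl, hS⟩ (by simp [hl])
            rwa [if_neg] at h1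
            rw [← hset, not_le]
            calc v < (insert k A).card := by omega
              _ ≤ _ := Finset.card_le_card Finset.subset_union_left
          rw [h0]
          simpa using hB0
      calc ‖∑ k, walkSum δ w k j (fun S => f ((q, i, k) :: S))‖
          ≤ ∑ k, ‖walkSum δ w k j (fun S => f ((q, i, k) :: S))‖ := norm_sum_le _ _
        _ = ∑ k ∈ A, ‖walkSum δ w k j (fun S => f ((q, i, k) :: S))‖ +
            ∑ k ∈ Aᶜ, ‖walkSum δ w k j (fun S => f ((q, i, k) :: S))‖ :=
          (Finset.sum_add_sum_compl _ _).symm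
        _ ≤ ∑ k ∈ A, B + ∑ k ∈ Aᶜ, B / Fintype.card ι := by
          gcongr with k hk k hk
          · exact hin k hk
          · rw [le_div_iff₀ (by positivity), mul_comm]
            exact hout k hk
        _ ≤ v * B + B := by
          rw [Finset.sum_const, Finset.sum_const, nsmul_eq_mul, nsmul_eq_mul]
          gcongr
          rw [mul_div_assoc', div_le_iff₀ (by positivity), mul_comm]
          gcongr
          exact Finset.card_le_univ _
        _ ≤ D * (v + 1) * B := by
          have : 0 ≤ (v + 1 : ℝ) * B := by positivity
          nlinarith
        _ = _ := by rw [hB, List.length_cons, pow_succ]; ring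
    · simp only [walkSum, norm_mul]
      have h1 := ih hi hA (fun k i h => hδ k i (List.mem_cons_of_mem _ h)) hf
      have h2 := hδ k i List.mem_cons_self
      calc _ ≤ D * _ := by gcongr
        _ ≤ D * (v + 1) * (κ * (D * (v + 1)) ^ w.length *
            (Fintype.card ι : ℝ) ^ (v - A.card)) := by
          gcongr
          nlinarith [(Nat.cast_nonneg v : (0 : ℝ) ≤ v)]
        _ = _ := by rw [List.length_cons, pow_succ]; ring

end Walks

section Edges
variable {Q ι : Type*} [LinearOrder ι]

/-- The undirected edge of a step. -/
def stepEdge (t : Q × ι × ι) : {e : ι × ι // e.1 ≤ e.2} :=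
  if h : t.2.1 ≤ t.2.2 then ⟨(t.2.1, t.2.2), h⟩ else ⟨(t.2.2, t.2.1), (not_le.1 h).le⟩

theorem stepEdge_eq_iff {t t' : Q × ι × ι} : stepEdge t = stepEdge t' ↔
    (t.2.1 = t'.2.1 ∧ t.2.2 = t'.2.2) ∨ (t.2.1 = t'.2.2 ∧ t.2.2 = t'.2.1) := by
  unfold stepEdge
  split_ifs with h1 h2 h2 <;> simp only [Subtype.mk.injEq, Prod.mk.injEq] <;> grind

theorem stepEdge_cases (t : Q × ι × ι) :
    ((stepEdge t).1.1 = t.2.1 ∧ (stepEdge t).1.2 = t.2.2) ∨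
      ((stepEdge t).1.1 = t.2.2 ∧ (stepEdge t).1.2 = t.2.1) := by
  unfold stepEdge
  split_ifs <;> simp

/-- The undirected edges of a walk. -/
def edges (S : List (Q × ι × ι)) : Finset {e : ι × ι // e.1 ≤ e.2} := (S.map stepEdge).toFinset

@[simp] theorem edges_nil : edges ([] : List (Q × ι × ι)) = ∅ := rfl

@[simp] theorem edges_cons (t : Q × ι × ι) (S : List (Q × ι × ι)) :
    edges (t :: S) = insert (stepEdge t) (edges S) := by simp [edges]

theorem edges_append (S T : List (Q × ι × ι)) : edges (S ++ T) = edges S ∪ edges T := by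
  simp [edges]

theorem mem_edges {S : List (Q × ι × ι)} {e : {e : ι × ι // e.1 ≤ e.2}} :
    e ∈ edges S ↔ ∃ t ∈ S, stepEdge t = e := by simp [edges]

/-- A walk that starts in a set of vertices `A` visits at most as many vertices outside of `A` as it
has edges outside of a set of edges `F` with both ends in `A`. -/
theorem IsWalk.card_add_card_le {S : List (Q × ι × ι)} {i j : ι} (hS : IsWalk S i j)
    {A : Finset ι} {F : Finset {e : ι × ι // e.1 ≤ e.2}} (hi : i ∈ A)
    (hF : ∀ e ∈ F, e.1.1 ∈ A ∧ e.1.2 ∈ A) :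
    (A ∪ targets S).card + F.card ≤ A.card + (F ∪ edges S).card := by
  induction S generalizing i A F with
  | nil => simp
  | cons t S ih =>
    obtain ⟨h1, h2⟩ := hS
    have hset : A ∪ targets (t :: S) = insert t.2.2 A ∪ targets S := by
      rw [targets_cons, Finset.union_insert, Finset.insert_union]
    have hset' : F ∪ edges (t :: S) = insert (stepEdge t) F ∪ edges S := by
      rw [edges_cons, Finset.union_insert, Finset.insert_union]
    rw [hset, hset']
    by_cases hk : t.2.2 ∈ A
    · rw [Finset.insert_eq_of_mem hk]
      refine (ih h2 hk hF).trans ?_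
      gcongr
      exact Finset.subset_insert _ _
    · have hne : stepEdge t ∉ F := fun h => by
        have := hF _ h
        rcases stepEdge_cases t with h' | h'
        · exact hk (h'.2 ▸ this.2)
        · exact hk (h'.1 ▸ this.1)
      have := ih (A := insert t.2.2 A) (F := insert (stepEdge t) F) h2
        (Finset.mem_insert_self _ _) (fun e he => by
          rcases Finset.mem_insert.1 he with rfl | he
          · rcases stepEdge_cases t with h' | h' <;> rw [h'.1, h'.2, h1] <;> simp [hi]
          · exact ⟨Finset.mem_insert_of_mem (hF e he).1, Finset.mem_insert_of_mem (hF e he).2⟩)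
      rw [Finset.card_insert_of_notMem hk, Finset.card_insert_of_notMem hne] at this
      omega

theorem IsWalk.end_mem {S : List (Q × ι × ι)} {i j : ι} (hS : IsWalk S i j) :
    j ∈ insert i (targets S) := by
  induction S generalizing i with
  | nil => simp [show i = j from hS]
  | cons t S ih =>
    have := ih hS.2
    rw [targets_cons]
    exact Finset.mem_insert_of_mem this

theorem IsWalk.ends_mem {S : List (Q × ι × ι)} {i j : ι} (hS : IsWalk S i j) {t : Q × ι × ι}
    (ht : t ∈ S) : t.2.1 ∈ insert i (targets S) ∧ t.2.2 ∈ insert i (targets S) := by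
  obtain ⟨S₁, S₂, rfl⟩ := List.append_of_mem ht
  obtain ⟨k, h1, h2⟩ := isWalk_append.1 hS
  have h3 := h1.end_mem
  have h4 := h2.1
  rw [targets_append, targets_cons]
  refine ⟨?_, by simp⟩
  rw [h4]
  simp only [Finset.mem_insert, Finset.mem_union] at h3 ⊢
  tauto

theorem IsWalk.edge_ends_mem {S : List (Q × ι × ι)} {i j : ι} (hS : IsWalk S i j) :
    ∀ e ∈ edges S, e.1.1 ∈ insert i (targets S) ∧ e.1.2 ∈ insert i (targets S) := by
  intro e he
  obtain ⟨t, ht, rfl⟩ := mem_edges.1 he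
  have := hS.ends_mem ht
  rcases stepEdge_cases t with h | h <;> rw [h.1, h.2]
  · exact this
  · exact this.symm

theorem IsWalk.card_le {S : List (Q × ι × ι)} {i j : ι} (hS : IsWalk S i j) :
    (insert i (targets S)).card ≤ (edges S).card + 1 := by
  have := hS.card_add_card_le (A := {i}) (F := ∅) (by simp) (by simp)
  simp only [Finset.card_empty, Finset.card_singleton, Finset.empty_union, ← Finset.insert_eq]
    at this
  omega

/-- Two walks with the same starting point. -/
theorem IsWalk.card_union_le_of_same_start {S T : List (Q × ι × ι)} {i j k : ι}
    (hS : IsWalk S i j) (hT : IsWalk T i k) :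
    (insert i (targets S ∪ targets T)).card ≤ (edges S ∪ edges T).card + 1 := by
  have h1 := hS.card_le
  have h2 := hT.card_add_card_le (A := insert i (targets S)) (by simp) hS.edge_ends_mem
  rw [Finset.insert_union] at h2
  omega

/-- A walk and a closed walk with a common edge. -/
theorem IsWalk.card_union_le_of_common_edge {S T : List (Q × ι × ι)} {i j k : ι}
    (hS : IsWalk S i j) (hT : IsWalk T k k) {e : {e : ι × ι // e.1 ≤ e.2}} (h1 : e ∈ edges S)
    (h2 : e ∈ edges T) :
    (insert i (targets S) ∪ insert k (targets T)).card ≤ (edges S ∪ edges T).card + 1 := by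
  obtain ⟨t, ht, rfl⟩ := mem_edges.1 h2
  obtain ⟨T₁, T₂, rfl⟩ := List.append_of_mem ht
  obtain ⟨z, hT1, hT2⟩ := isWalk_append.1 hT
  have hz : z ∈ insert i (targets S) := by
    have := hS.edge_ends_mem _ h1
    rw [← hT2.1]
    rcases stepEdge_cases t with h | h <;> rw [h.1, h.2] at this
    · exact this.1
    · exact this.2
  have c1 := hS.card_le
  have c2 := hT2.card_add_card_le hz hS.edge_ends_mem
  have hk : k ∈ insert i (targets S) ∪ targets (t :: T₂) := by
    have := hT2.end_mem
    rcases Finset.mem_insert.1 this with h | h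
    · exact Finset.mem_union_left _ (h ▸ hz)
    · exact Finset.mem_union_right _ h
  have c3 := hT1.card_add_card_le (F := edges S ∪ edges (t :: T₂)) hk (fun e he => by
    rcases Finset.mem_union.1 he with he | he
    · have := hS.edge_ends_mem e he
      exact ⟨Finset.mem_union_left _ this.1, Finset.mem_union_left _ this.2⟩
    · have := hT2.edge_ends_mem e he
      have hsub : insert z (targets (t :: T₂)) ⊆ insert i (targets S) ∪ targets (t :: T₂) := by
        intro x hx
        rcases Finset.mem_insert.1 hx with rfl | hx
        · exact Finset.mem_union_left _ hz
        · exact Finset.mem_union_right _ hx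
      exact ⟨hsub this.1, hsub this.2⟩)
  have s1 : insert i (targets S) ∪ insert k (targets (T₁ ++ t :: T₂)) =
      insert i (targets S) ∪ targets (t :: T₂) ∪ targets T₁ := by
    rw [targets_append, Finset.union_insert, Finset.insert_eq_of_mem, Finset.union_comm (targets T₁),
      Finset.union_assoc]
    rw [Finset.union_comm (targets T₁), ← Finset.union_assoc]
    exact Finset.mem_union_left _ hk
  have s2 : edges S ∪ edges (T₁ ++ t :: T₂) = edges S ∪ edges (t :: T₂) ∪ edges T₁ := by
    rw [edges_append, Finset.union_comm (edges T₁), Finset.union_assoc]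
  rw [s1, s2]
  omega

theorem sum_count_edges (S : List (Q × ι × ι)) :
    ∑ e ∈ edges S, (S.map stepEdge).count e = S.length := by
  have h := List.sum_toFinset_count_eq_length (S.map stepEdge)
  rw [List.length_map] at h
  rw [← h]
  refine Finset.sum_congr rfl fun e _ => ?_
  congr 1
  exact lawful_beq_subsingleton _ _

/-- In a closed walk of `n` steps with at least `n / 2 + 1` vertices that passes no edge only once,
the edge of the first step is passed exactly once more, in the opposite direction, and it
separates two parts that have no edge in common. -/
theorem IsWalk.exists_split {t : Q × ι × ι} {S : List (Q × ι × ι)} {i : ι}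
    (hS : IsWalk (t :: S) i i)
    (hV : (t :: S).length + 2 ≤ 2 * (insert i (targets (t :: S))).card)
    (hcount : ∀ e ∈ edges (t :: S), 2 ≤ ((t :: S).map stepEdge).count e) :
    ∃ S₁ b S₂, S = S₁ ++ b :: S₂ ∧ b.2.1 = t.2.2 ∧ b.2.2 = t.2.1 ∧
      (∀ s ∈ S₁, stepEdge s ≠ stepEdge t) ∧ (∀ s ∈ S₂, stepEdge s ≠ stepEdge t) ∧
      ∀ s ∈ S₁, ∀ s' ∈ S₂, stepEdge s ≠ stepEdge s' := by
  have hE := hS.card_le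
  have hsum := sum_count_edges (t :: S)
  have h2 : 2 * (edges (t :: S)).card ≤ (t :: S).length := by
    rw [← hsum, mul_comm, ← smul_eq_mul]
    exact Finset.card_nsmul_le_sum _ _ _ hcount
  have hlen : (t :: S).length = 2 * (edges (t :: S)).card := by omega
  have hcount2 : ∀ e ∈ edges (t :: S), ((t :: S).map stepEdge).count e = 2 := by
    by_contra! hcon
    obtain ⟨e, he, hne⟩ := hcon
    have : ∑ e ∈ edges (t :: S), 2 < ∑ e ∈ edges (t :: S), ((t :: S).map stepEdge).count e :=
      Finset.sum_lt_sum hcount ⟨e, he, lt_of_le_of_ne (hcount e he) hne.symm⟩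
    rw [Finset.sum_const, smul_eq_mul, hsum] at this
    omega
  have hc := hcount2 (stepEdge t) (by simp)
  rw [List.map_cons, List.count_cons_self] at hc
  have hmem : stepEdge t ∈ S.map stepEdge := List.count_pos_iff.1 (by omega)
  obtain ⟨b, hb, hbt⟩ := List.mem_map.1 hmem
  obtain ⟨S₁, S₂, rfl⟩ := List.append_of_mem hb
  rw [List.map_append, List.map_cons, hbt, List.count_append, List.count_cons_self] at hc
  have hn1 : stepEdge t ∉ S₁.map stepEdge := fun h => by
    have := List.count_pos_iff.2 h; omega
  have hn2 : stepEdge t ∉ S₂.map stepEdge := fun h => by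
    have := List.count_pos_iff.2 h; omega
  have hti : t.2.1 = i := hS.1
  obtain ⟨z, hw1, hbz, hw2⟩ := isWalk_append.1 hS.2
  have hsubE : (edges S₁ ∪ edges S₂).card + 1 ≤ (edges (t :: (S₁ ++ b :: S₂))).card := by
    rw [← Finset.card_insert_of_notMem (a := stepEdge t)]
    · refine Finset.card_le_card ?_
      rw [edges_cons, edges_append, edges_cons]
      refine Finset.insert_subset_insert _ (Finset.union_subset_union_right ?_)
      exact Finset.subset_insert _ _
    · simp only [edges, Finset.mem_union, List.mem_toFinset]
      tauto
  have hV' : insert i (targets (t :: (S₁ ++ b :: S₂))) =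
      insert i (insert t.2.2 (targets S₁ ∪ insert b.2.2 (targets S₂))) := by
    rw [targets_cons, targets_append, targets_cons]
  have hopp : b.2.1 = t.2.2 ∧ b.2.2 = t.2.1 := by
    rcases stepEdge_eq_iff.1 hbt with h | h
    · exfalso
      rw [h.2] at hw2
      have c := hw1.card_union_le_of_same_start hw2
      have hi : i ∈ insert t.2.2 (targets S₂) := hw2.end_mem
      have : insert i (insert t.2.2 (targets S₁ ∪ insert b.2.2 (targets S₂))) =
          insert t.2.2 (targets S₁ ∪ targets S₂) := by
        have hi' : i ∈ insert t.2.2 (targets S₁ ∪ targets S₂) := by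
          rcases Finset.mem_insert.1 hi with h | h
          · exact h ▸ Finset.mem_insert_self _ _
          · exact Finset.mem_insert_of_mem (Finset.mem_union_right _ h)
        rw [h.2, Finset.union_insert, Finset.insert_idem, Finset.insert_eq_of_mem hi']
      rw [hV', this] at hV
      omega
    · exact h
  refine ⟨S₁, b, S₂, rfl, hopp.1, hopp.2, ?_, ?_, ?_⟩
  · intro s hs h
    exact hn1 (List.mem_map.2 ⟨s, hs, h⟩)
  · intro s hs h
    exact hn2 (List.mem_map.2 ⟨s, hs, h⟩)
  · intro s hs s' hs' h
    rw [hopp.2, hti] at hw2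
    have c := hw1.card_union_le_of_common_edge hw2 (mem_edges.2 ⟨s, hs, rfl⟩)
      (mem_edges.2 ⟨s', hs', h.symm⟩)
    have : insert i (insert t.2.2 (targets S₁ ∪ insert b.2.2 (targets S₂))) =
        insert t.2.2 (targets S₁) ∪ insert i (targets S₂) := by
      rw [hopp.2, hti, Finset.insert_union, Finset.insert_eq_of_mem]
      simp
    rw [hV', this] at hV
    omega

end Edges

section Entries

/-- The conditions on a single size of a family of random matrices: entries in `L^{∞-}`, centred,
self-adjoint, and independent entries on and above the diagonal. -/
structure IsIndependentSelfAdjoint {Q ι Ω : Type*} [LinearOrder ι] [MeasurableSpace Ω]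
    (P : Measure Ω) (Y : Q → Matrix ι ι (Ω → ℂ)) : Prop where
  memLp : ∀ q i j (p : ENNReal), p ≠ ⊤ → MemLp (Y q i j) p P
  mean_zero : ∀ q i j, ∫ ω, Y q i j ω ∂P = 0
  selfAdjoint : ∀ q i j, ∀ᵐ ω ∂P, Y q j i ω = star (Y q i j ω)
  indep : iIndepFun
    (fun (e : {e : ι × ι // e.1 ≤ e.2}) (ω : Ω) (q : Q) => Y q e.1.1 e.1.2 ω) P

/-- The expectation of a product of matrix entries. -/
noncomputable def entryMoment {Q ι Ω : Type*} [MeasurableSpace Ω]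
    (P : Measure Ω) (Y : Q → Matrix ι ι (Ω → ℂ)) (S : List (Q × ι × ι)) : ℂ :=
  ∫ ω, (S.map fun t => Y t.1 t.2.1 t.2.2 ω).prod ∂P

theorem memLp_list_prod {Ω α : Type*} [MeasurableSpace Ω] {P : Measure Ω} [IsProbabilityMeasure P]
    {f : α → Ω → ℂ} (hf : ∀ a (p : ENNReal), p ≠ ⊤ → MemLp (f a) p P) (S : List α) (p : ENNReal)
    (hp : p ≠ ⊤) : MemLp (fun ω => (S.map fun a => f a ω).prod) p P := by
  induction S generalizing p with
  | nil => simpa using memLp_const 1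
  | cons a S ih =>
    have hp2 : 2 * p ≠ ⊤ := ENNReal.mul_ne_top (by simp) hp
    have : ENNReal.HolderTriple (2 * p) (2 * p) p := ⟨by
      rw [ENNReal.mul_inv (by simp) (by simp), ← add_mul, ENNReal.inv_two_add_inv_two, one_mul]⟩
    simp only [List.map_cons, List.prod_cons]
    exact (ih (2 * p) hp2).mul' (hf a (2 * p) hp2)

theorem entryMoment_nil {Q ι Ω : Type*} [MeasurableSpace Ω] (P : Measure Ω)
    [IsProbabilityMeasure P] (Y : Q → Matrix ι ι (Ω → ℂ)) : entryMoment P Y [] = 1 := by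
  simp [entryMoment]

theorem entryMoment_perm {Q ι Ω : Type*} [MeasurableSpace Ω]
    (P : Measure Ω) (Y : Q → Matrix ι ι (Ω → ℂ)) {S T : List (Q × ι × ι)} (h : S.Perm T) :
    entryMoment P Y S = entryMoment P Y T := by
  unfold entryMoment
  congr 1
  funext ω
  exact (h.map _).prod_eq

theorem prod_prod_filter_stepEdge {Q ι M : Type*} [LinearOrder ι] [Fintype ι] [CommMonoid M]
    (g : Q × ι × ι → M) (S : List (Q × ι × ι)) :
    ∏ e, ((S.filter (stepEdge · = e)).map g).prod = (S.map g).prod := by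
  induction S with
  | nil => simp
  | cons t S ih =>
    rw [List.map_cons, List.prod_cons, ← ih]
    have : ∀ e, (((t :: S).filter (stepEdge · = e)).map g).prod =
        (if stepEdge t = e then g t else 1) * ((S.filter (stepEdge · = e)).map g).prod := by
      intro e
      by_cases h : stepEdge t = e
      · rw [List.filter_cons_of_pos (by simpa using h)]; simp [h]
      · rw [List.filter_cons_of_neg (by simpa using h)]; simp [h]
    simp_rw [this, Finset.prod_mul_distrib]
    simp

namespace IsIndependentSelfAdjoint
variable {Q ι Ω : Type*} [LinearOrder ι] [MeasurableSpace Ω]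
  {P : Measure Ω} [IsProbabilityMeasure P] {Y : Q → Matrix ι ι (Ω → ℂ)}

theorem integrable_prod (h : IsIndependentSelfAdjoint P Y) (S : List (Q × ι × ι)) :
    Integrable (fun ω => (S.map fun t => Y t.1 t.2.1 t.2.2 ω).prod) P :=
  memLp_one_iff_integrable.1
    (memLp_list_prod (f := fun t : Q × ι × ι => Y t.1 t.2.1 t.2.2)
      (fun t => h.memLp t.1 t.2.1 t.2.2) S 1 (by simp))

theorem entryMoment_eq_prod [Fintype ι] (h : IsIndependentSelfAdjoint P Y)
    (S : List (Q × ι × ι)) :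
    entryMoment P Y S = ∏ e, entryMoment P Y (S.filter (stepEdge · = e)) := by
  set f : {e : ι × ι // e.1 ≤ e.2} → (Q → ℂ) → ℂ := fun e y =>
    ((S.filter (stepEdge · = e)).map fun t => if t.2.1 ≤ t.2.2 then y t.1 else star (y t.1)).prod
  have hfm : ∀ e, Measurable (f e) := by
    intro e
    have : ∀ T : List (Q × ι × ι), Measurable fun y : Q → ℂ =>
        (T.map fun t => if t.2.1 ≤ t.2.2 then y t.1 else star (y t.1)).prod := by
      intro T
      induction T with
      | nil => simp
      | cons t T ih =>
        simp only [List.map_cons, List.prod_cons]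
        refine Measurable.mul ?_ ih
        split_ifs
        · exact measurable_pi_apply _
        · exact continuous_star.measurable.comp (measurable_pi_apply _)
    exact this _
  have hae : ∀ᵐ ω ∂P, ∀ e, f e (fun q => Y q e.1.1 e.1.2 ω) =
      ((S.filter (stepEdge · = e)).map fun t => Y t.1 t.2.1 t.2.2 ω).prod := by
    have h1 : ∀ᵐ ω ∂P, ∀ t ∈ {t | t ∈ S},
        Y t.1 t.2.1 t.2.2 ω = star (Y t.1 t.2.2 t.2.1 ω) :=
      (ae_ball_iff S.finite_toSet.countable).2 fun t _ => h.selfAdjoint t.1 t.2.2 t.2.1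
    filter_upwards [h1] with ω hω e
    refine congrArg List.prod (List.map_congr_left fun t ht => ?_)
    obtain ⟨htS, hte⟩ := List.mem_filter.1 ht
    have hte : stepEdge t = e := by simpa using hte
    subst hte
    unfold stepEdge
    split_ifs with h2
    · rfl
    · exact (hω t htS).symm
  have hint : ∀ e, (fun ω => f e (fun q => Y q e.1.1 e.1.2 ω)) =ᵐ[P]
      fun ω => ((S.filter (stepEdge · = e)).map fun t => Y t.1 t.2.1 t.2.2 ω).prod :=
    fun e => hae.mono fun ω hω => hω e
  have hind := h.indep.comp f hfm
  have key := hind.integral_fun_prod_eq_prod_integral fun e =>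
    (h.integrable_prod _).aestronglyMeasurable.congr (hint e).symm
  unfold entryMoment
  calc ∫ ω, (S.map fun t => Y t.1 t.2.1 t.2.2 ω).prod ∂P
      = ∫ ω, ∏ e, f e (fun q => Y q e.1.1 e.1.2 ω) ∂P := by
        refine integral_congr_ae ?_
        filter_upwards [hae] with ω hω
        simp_rw [hω]
        rw [prod_prod_filter_stepEdge (fun t => Y t.1 t.2.1 t.2.2 ω)]
    _ = _ := key.trans (Finset.prod_congr rfl fun e _ => integral_congr_ae (hint e))

theorem entryMoment_append [Fintype ι] (h : IsIndependentSelfAdjoint P Y)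
    {S T : List (Q × ι × ι)} (hST : ∀ s ∈ S, ∀ t ∈ T, stepEdge s ≠ stepEdge t) :
    entryMoment P Y (S ++ T) = entryMoment P Y S * entryMoment P Y T := by
  rw [h.entryMoment_eq_prod, h.entryMoment_eq_prod S, h.entryMoment_eq_prod T,
    ← Finset.prod_mul_distrib]
  refine Finset.prod_congr rfl fun e _ => ?_
  rw [List.filter_append]
  by_cases hS : S.filter (stepEdge · = e) = []
  · rw [hS, List.nil_append, entryMoment_nil, one_mul]
  · have hT : T.filter (stepEdge · = e) = [] := by
      obtain ⟨s, hs⟩ := List.exists_mem_of_ne_nil _ hS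
      rw [List.filter_eq_nil_iff]
      intro t ht hte
      have h1 := List.mem_filter.1 hs
      exact hST s h1.1 t ht (by
        rw [decide_eq_true_eq] at hte
        rw [hte]
        simpa using h1.2)
    rw [hT, List.append_nil, entryMoment_nil, mul_one]

theorem entryMoment_eq_zero [Fintype ι] (h : IsIndependentSelfAdjoint P Y)
    {S : List (Q × ι × ι)} {e : {e : ι × ι // e.1 ≤ e.2}}
    (he : (S.map stepEdge).count e = 1) : entryMoment P Y S = 0 := by
  have hmem : e ∈ S.map stepEdge := List.count_pos_iff.1 (by omega)
  obtain ⟨t, ht, rfl⟩ := List.mem_map.1 hmem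
  obtain ⟨S₁, S₂, rfl⟩ := List.append_of_mem ht
  rw [List.map_append, List.map_cons, List.count_append, List.count_cons_self] at he
  have h1 : stepEdge t ∉ S₁.map stepEdge := fun h => by
    have := List.count_pos_iff.2 h; omega
  have h2 : stepEdge t ∉ S₂.map stepEdge := fun h => by
    have := List.count_pos_iff.2 h; omega
  rw [entryMoment_perm P Y (List.perm_middle (l₁ := S₁) (l₂ := S₂) (a := t)),
    show t :: (S₁ ++ S₂) = [t] ++ (S₁ ++ S₂) from rfl, h.entryMoment_append]
  · rw [show entryMoment P Y [t] = 0 by simpa [entryMoment] using h.mean_zero t.1 t.2.1 t.2.2,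
      zero_mul]
  · intro s hs t' ht' hst
    rw [List.mem_singleton.1 hs] at hst
    rcases List.mem_append.1 ht' with h' | h'
    · exact h1 (List.mem_map.2 ⟨t', h', hst.symm⟩)
    · exact h2 (List.mem_map.2 ⟨t', h', hst.symm⟩)

theorem norm_entryMoment_le [Fintype ι] (h : IsIndependentSelfAdjoint P Y) {χ : List Q} {β : ℝ}
    (hβ : ∀ (e : {e : ι × ι // e.1 ≤ e.2}) (S : List (Q × ι × ι)), (∀ s ∈ S, stepEdge s = e) →
      (S.map Prod.fst).Sublist χ → ‖entryMoment P Y S‖ ≤ β ^ S.length)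
    {S : List (Q × ι × ι)} (hS : (S.map Prod.fst).Sublist χ) :
    ‖entryMoment P Y S‖ ≤ β ^ S.length := by
  rw [h.entryMoment_eq_prod, norm_prod]
  have h1 := prod_prod_filter_stepEdge (fun _ => β) S
  simp only [List.map_const', List.prod_replicate] at h1
  rw [← h1]
  refine Finset.prod_le_prod (fun _ _ => norm_nonneg _) fun e _ => ?_
  refine hβ e _ (fun s hs => by simpa using (List.mem_filter.1 hs).2) ?_
  exact (List.filter_sublist.map _).trans hS

/-- The expectation along a closed walk with many vertices factorizes along the pairings of its
first step. -/
theorem entryMoment_eq_splitSum [Fintype ι] (h : IsIndependentSelfAdjoint P Y)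
    {t : Q × ι × ι} {S : List (Q × ι × ι)} {i : ι} (hS : IsWalk (t :: S) i i)
    (hV : (t :: S).length + 2 ≤ 2 * (insert i (targets (t :: S))).card) :
    entryMoment P Y (t :: S) = splitSum S fun S₁ b S₂ =>
      if b.2.1 = t.2.2 ∧ b.2.2 = t.2.1 then
        entryMoment P Y [t, b] * entryMoment P Y S₁ * entryMoment P Y S₂ else 0 := by
  by_cases hcount : ∀ e ∈ edges (t :: S), 2 ≤ ((t :: S).map stepEdge).count e
  · obtain ⟨S₁, b, S₂, rfl, hb1, hb2, hn1, hn2, hdisj⟩ := hS.exists_split hV hcount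
    have hbt : stepEdge b = stepEdge t := stepEdge_eq_iff.2 (Or.inr ⟨hb1, hb2⟩)
    rw [splitSum_append, splitSum, splitSum_eq_zero, splitSum_eq_zero, List.append_nil, zero_add,
      add_zero, if_pos ⟨hb1, hb2⟩]
    · have hp : (t :: (S₁ ++ b :: S₂)).Perm ([t, b] ++ (S₁ ++ S₂)) :=
        List.Perm.cons t List.perm_middle
      rw [entryMoment_perm P Y hp, h.entryMoment_append, h.entryMoment_append hdisj, mul_assoc]
      intro s hs s' hs'
      have hst : stepEdge s = stepEdge t := by
        simp only [List.mem_cons, List.not_mem_nil, or_false] at hs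
        rcases hs with rfl | rfl
        · rfl
        · exact hbt
      rw [hst]
      rcases List.mem_append.1 hs' with h' | h'
      · exact (hn1 s' h').symm
      · exact (hn2 s' h').symm
    · intro u c v hc
      rw [if_neg]
      intro hc'
      exact hn2 c (by rw [hc]; simp) (stepEdge_eq_iff.2 (Or.inr hc'))
    · intro u c v hc
      rw [if_neg]
      intro hc'
      exact hn1 c (by rw [hc]; simp) (stepEdge_eq_iff.2 (Or.inr hc'))
  · push Not at hcount
    obtain ⟨e, he, hlt⟩ := hcount
    have hpos : 0 < ((t :: S).map stepEdge).count e :=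
      List.count_pos_iff.2 (by simpa [edges] using he)
    have hone : ((t :: S).map stepEdge).count e = 1 := by omega
    rw [h.entryMoment_eq_zero hone, splitSum_eq_zero]
    rintro S₁ b S₂ rfl
    split_ifs with hb
    · have hbt : stepEdge b = stepEdge t := stepEdge_eq_iff.2 (Or.inr hb)
      simp only [List.map_cons, List.map_append, List.count_cons, List.count_append, hbt] at hone
      have : (S₁.map stepEdge).count e = 1 ∨ (S₂.map stepEdge).count e = 1 := by
        split_ifs at hone <;> omega
      rcases this with h' | h' <;> rw [h.entryMoment_eq_zero h'] <;> simp
    · rfl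

end IsIndependentSelfAdjoint

end Entries

section Moments
variable {Q K' Ω : Type*} [MeasurableSpace Ω] {N : ℕ}

/-- The matrix of a letter. -/
noncomputable def letterMatrix (Y : Q → Matrix (Fin N) (Fin N) (Ω → ℂ)) (δ : K' → Fin N → ℂ) :
    Q ⊕ K' → Matrix (Fin N) (Fin N) (Ω → ℂ) :=
  Sum.elim Y fun k => constMatrix Ω (Matrix.diagonal (δ k))

/-- The joint moment of random matrices and diagonal matrices along a word. -/
noncomputable def wordMoment (P : Measure Ω) (Y : Q → Matrix (Fin N) (Fin N) (Ω → ℂ))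
    (δ : K' → Fin N → ℂ) (w : List (Q ⊕ K')) : ℂ :=
  meanNormTrace P ((w.map (letterMatrix Y δ)).prod)

variable {P : Measure Ω} [IsProbabilityMeasure P] {Y : Q → Matrix (Fin N) (Fin N) (Ω → ℂ)}
  (δ : K' → Fin N → ℂ)

theorem IsIndependentSelfAdjoint.integrable_word (h : IsIndependentSelfAdjoint P Y)
    (w : List (Q ⊕ K')) (i j : Fin N) :
    Integrable ((w.map (letterMatrix Y δ)).prod i j) P ∧
    ∫ ω, (w.map (letterMatrix Y δ)).prod i j ω ∂P = walkSum δ w i j (entryMoment P Y) := by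
  have h1 := integral_walkSum δ P w i j
    (fun S ω => (S.map fun t => Y t.1 t.2.1 t.2.2 ω).prod) h.integrable_prod
  have h2 : (w.map (letterMatrix Y δ)).prod i j = fun ω => walkSum δ w i j
      (fun S => (S.map fun t => Y t.1 t.2.1 t.2.2 ω).prod) := by
    funext ω
    exact list_prod_apply_eq_walkSum δ Y w i j ω
  rw [h2]
  exact h1

theorem IsIndependentSelfAdjoint.wordMoment_eq (h : IsIndependentSelfAdjoint P Y)
    (w : List (Q ⊕ K')) :
    wordMoment P Y δ w = (N : ℂ)⁻¹ * ∑ i, walkSum δ w i i (entryMoment P Y) := by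
  unfold wordMoment meanNormTrace
  congr 1
  exact Finset.sum_congr rfl fun i _ => (h.integrable_word δ w i i).2

theorem IsIndependentSelfAdjoint.wordMoment_comm (h : IsIndependentSelfAdjoint P Y)
    (u v : List (Q ⊕ K')) : wordMoment P Y δ (u ++ v) = wordMoment P Y δ (v ++ u) := by
  have key : ∀ w : List (Q ⊕ K'), wordMoment P Y δ w =
      (N : ℂ)⁻¹ * ∫ ω, (w.map (letterMatrix Y δ)).prod.trace ω ∂P := by
    intro w
    unfold wordMoment meanNormTrace
    rw [← integral_finsetSum _ fun i _ => (h.integrable_word δ w i i).1]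
    simp [Matrix.trace, Finset.sum_apply]
  rw [key, key, List.map_append, List.map_append, List.prod_append, List.prod_append,
    Matrix.trace_mul_comm]

theorem IsIndependentSelfAdjoint.wordMoment_map_inr (h : IsIndependentSelfAdjoint P Y)
    (l : List K') : wordMoment P Y δ (l.map Sum.inr) =
      jointMoment (normTrace (N := N)) (fun k' => Matrix.diagonal (δ k')) l := by
  have h1 : (l.map fun k' => Matrix.diagonal (δ k')).prod =
      Matrix.diagonal (fun i => (l.map (δ · i)).prod) := by
    induction l with
    | nil => simp
    | cons k l ih => simp [ih]
  rw [h.wordMoment_eq, jointMoment, normTrace, h1, Matrix.trace_diagonal]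
  congr 1
  refine Finset.sum_congr rfl fun i _ => ?_
  have := walkSum_map_inr_append δ l [] i i (entryMoment P Y)
  rw [List.append_nil] at this
  rw [this]
  simp [walkSum, entryMoment_nil]

/-- The sum over the pairings of the first step of a walk. -/
noncomputable def pairedMoment (P : Measure Ω) (Y : Q → Matrix (Fin N) (Fin N) (Ω → ℂ)) :
    List (Q × Fin N × Fin N) → ℂ
  | [] => 0
  | t :: S => splitSum S fun S₁ b S₂ =>
      if b.2.1 = t.2.2 ∧ b.2.2 = t.2.1 then
        entryMoment P Y [t, b] * entryMoment P Y S₁ * entryMoment P Y S₂ else 0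

theorem IsIndependentSelfAdjoint.sum_walkSum_pairedMoment (h : IsIndependentSelfAdjoint P Y)
    {c : Q → Q → ℂ}
    (hc : ∀ a b i j, ∫ ω, Y a i j ω * Y b j i ω ∂P = c a b / N)
    (l : List K') (a : Q) (w : List (Q ⊕ K')) :
    (N : ℂ)⁻¹ * ∑ i, walkSum δ (l.map Sum.inr ++ Sum.inl a :: w) i i (pairedMoment P Y) =
      splitSum w fun u b v => Sum.elim (fun q => c a q * wordMoment P Y δ u *
        wordMoment P Y δ (l.map Sum.inr ++ v)) (fun _ => 0) b := by
  simp only [walkSum_map_inr_append, walkSum, pairedMoment, walkSum_splitSum]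
  simp only [← splitSum_finset_sum, splitSum_mul_left]
  refine splitSum_congr fun u b v _ => ?_
  rcases b with q | k'
  · simp only [Sum.elim_inl]
    have inner : ∀ i k : Fin N, (∑ p, ∑ r, walkSum δ u k p (fun S₁ => walkSum δ v r i (fun S₂ =>
        if p = k ∧ r = i then entryMoment P Y [(a, i, k), (q, p, r)] * entryMoment P Y S₁ *
          entryMoment P Y S₂ else 0))) =
        c a q / N * walkSum δ u k k (entryMoment P Y) * walkSum δ v i i (entryMoment P Y) := by
      intro i k
      rw [Finset.sum_eq_single k, Finset.sum_eq_single i]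
      · simp only [true_and, if_true]
        have : entryMoment P Y [(a, i, k), (q, k, i)] = c a q / N := by
          simpa [entryMoment] using hc a q i k
        simp only [this, mul_assoc, walkSum_mul_left]
        congr 1
        rw [mul_comm, ← walkSum_mul_left]
        congr 1
        funext S
        rw [mul_comm]
      · intro r _ hr
        simp [hr, walkSum_zero]
      · simp
      · intro p _ hp
        simp [hp, walkSum_zero]
      · simp
    simp only [inner]
    rw [h.wordMoment_eq, h.wordMoment_eq]
    simp only [walkSum_map_inr_append]
    simp only [← Finset.sum_mul, ← Finset.mul_sum]
    have e : ∀ i, (l.map (δ · i)).prod * (c a q / N * (∑ k, walkSum δ u k k (entryMoment P Y)) *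
        walkSum δ v i i (entryMoment P Y)) = (c a q / N * ∑ k, walkSum δ u k k (entryMoment P Y)) *
          ((l.map (δ · i)).prod * walkSum δ v i i (entryMoment P Y)) := fun i => by ring
    simp only [e, ← Finset.mul_sum]
    ring
  · simp

/-- A quantitative form of the recursion for the moments. -/
theorem IsIndependentSelfAdjoint.norm_sub_splitSum_le (h : IsIndependentSelfAdjoint P Y)
    {c : Q → Q → ℂ} (hc : ∀ a b i j, ∫ ω, Y a i j ω * Y b j i ω ∂P = c a b / N)
    (hN : 0 < N) (l : List K') (a : Q) (w : List (Q ⊕ K')) {B D : ℝ} (hB : 0 ≤ B) (hD : 1 ≤ D)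
    (hδ : ∀ k i, (Sum.inr k : Q ⊕ K') ∈ l.map Sum.inr ++ Sum.inl a :: w → ‖δ k i‖ ≤ D)
    (hβ : ∀ (e : {e : Fin N × Fin N // e.1 ≤ e.2}) (S : List (Q × Fin N × Fin N)),
      (∀ s ∈ S, stepEdge s = e) → (S.map Prod.fst).Sublist (a :: leftLetters w) →
      ‖entryMoment P Y S‖ ≤ (B / √N) ^ S.length) :
    ‖wordMoment P Y δ (l.map Sum.inr ++ Sum.inl a :: w) - splitSum w fun u b v =>
      Sum.elim (fun q => c a q * wordMoment P Y δ u *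
        wordMoment P Y δ (l.map Sum.inr ++ v)) (fun _ => 0) b‖ ≤
    ((leftLetters w).length + 1) * B ^ ((leftLetters w).length + 1) *
      (D * (((leftLetters w).length + 2) / 2 + 1)) ^ (l.map Sum.inr ++ Sum.inl a :: w).length *
        (√N)⁻¹ := by
  set n := (leftLetters w).length with hn
  set W := l.map Sum.inr ++ Sum.inl a :: w with hW
  have hletters : leftLetters W = a :: leftLetters w := by
    rw [hW]
    clear_value n
    clear hδ hW W
    induction l with
    | nil => rfl
    | cons k l ih => rw [List.map_cons, List.cons_append, leftLetters_inr, ih]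
  have hNr : (0 : ℝ) < N := by exact_mod_cast hN
  set s := √(N : ℝ) with hs
  have hs1 : 1 ≤ s := Real.one_le_sqrt.2 (by exact_mod_cast hN)
  have hss : s * s = N := Real.mul_self_sqrt hNr.le
  have hs0 : 0 < s := by linarith
  have hβ0 : 0 ≤ B / s := by positivity
  rw [← h.sum_walkSum_pairedMoment δ hc, h.wordMoment_eq, ← mul_sub, ← Finset.sum_sub_distrib]
  rw [Finset.sum_congr rfl fun i _ => (walkSum_sub δ W i i _ _).symm]
  set v := (n + 2) / 2 with hv
  set κ := (n + 1) * (B / s) ^ (n + 1) with hκ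
  have hbound : ∀ i : Fin N, ‖walkSum δ W i i (fun S => entryMoment P Y S - pairedMoment P Y S)‖ ≤
      κ * (D * (v + 1)) ^ W.length * (N : ℝ) ^ (v - 1) := by
    intro i
    have := norm_walkSum_le (δ := δ) (w := W) (i := i) (j := i)
      (f := fun S => entryMoment P Y S - pairedMoment P Y S) (A := {i}) (κ := κ) (D := D) (v := v)
      (by simp) (by simp; omega) (by positivity) hD hδ ?_
    · simpa using this
    · intro S hS hl
      rw [hletters] at hl
      rcases S with _ | ⟨t, S⟩
      · simp at hl
      have hlen : S.length = n := by
        have := congrArg List.length hl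
        simpa using this
      have hsub : ((t :: S).map Prod.fst).Sublist (a :: leftLetters w) := by rw [hl]
      split_ifs with hcard
      · have h1 := h.norm_entryMoment_le hβ hsub
        have h2 : ‖pairedMoment P Y (t :: S)‖ ≤ S.length * (B / s) ^ (n + 1) := by
          refine norm_splitSum_le ?_
          rintro S₁ b S₂ rfl
          split_ifs
          · have e1 := h.norm_entryMoment_le hβ (S := [t, b]) (List.Sublist.trans (by
              refine List.Sublist.map _ (List.Sublist.cons_cons _ ?_)
              rw [List.singleton_sublist]; simp) hsub)
            have e2 := h.norm_entryMoment_le hβ (S := S₁) (List.Sublist.trans (by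
              refine List.Sublist.map _ (List.Sublist.cons _ ?_)
              exact List.sublist_append_left _ _) hsub)
            have e3 := h.norm_entryMoment_le hβ (S := S₂) (List.Sublist.trans (by
              refine List.Sublist.map _ (List.Sublist.cons _ ?_)
              exact (List.sublist_cons_self _ _).trans (List.sublist_append_right _ _)) hsub)
            rw [norm_mul, norm_mul]
            calc _ ≤ (B / s) ^ [t, b].length * (B / s) ^ S₁.length * (B / s) ^ S₂.length := by
                  gcongr
              _ = _ := by
                rw [← pow_add, ← pow_add, ← hlen]
                congr 1
                simp
                omega
          · simpa using by positivity
        have h3 := norm_sub_le (entryMoment P Y (t :: S)) (pairedMoment P Y (t :: S))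
        rw [List.length_cons] at h1
        rw [hlen] at h1 h2
        rw [hκ]
        linarith
      · rw [h.entryMoment_eq_splitSum hS, pairedMoment, sub_self]
        rw [Finset.insert_eq]
        rw [List.length_cons]
        omega
  have hpow : (N : ℝ) ^ (v - 1) ≤ s ^ n := by
    rw [← hss, ← pow_two, ← pow_mul]
    exact pow_le_pow_right₀ hs1 (by omega)
  have hvr : (v : ℝ) ≤ ((n : ℝ) + 2) / 2 := by
    rw [hv]
    have := Nat.cast_div_le (α := ℝ) (m := n + 2) (n := 2)
    push_cast at this
    exact this
  rw [norm_mul, norm_inv, Complex.norm_natCast]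
  calc (N : ℝ)⁻¹ * ‖∑ i, walkSum δ W i i (fun S => entryMoment P Y S - pairedMoment P Y S)‖
      ≤ (N : ℝ)⁻¹ * ∑ i : Fin N, κ * (D * (v + 1)) ^ W.length * (N : ℝ) ^ (v - 1) := by
        gcongr
        exact norm_sum_le_of_le _ fun i _ => hbound i
    _ = κ * (D * (v + 1)) ^ W.length * (N : ℝ) ^ (v - 1) := by
        rw [Finset.sum_const, Finset.card_univ, Fintype.card_fin, nsmul_eq_mul]
        field_simp
    _ ≤ κ * (D * ((n + 2) / 2 + 1)) ^ W.length * s ^ n := by gcongr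
    _ = _ := by
        rw [hκ, div_pow, pow_succ s]
        field_simp

end Moments

section Limit

theorem prod_map_eq_prod_fin {α β M : Type*} [CommMonoid M] (f : α → β) (g : α → M) (S : List α)
    {χ : List β} (h : S.map f = χ) :
    (S.map g).prod = ∏ x : Fin χ.length, g (S.get (x.cast (by rw [← h, List.length_map]))) := by
  subst h
  rw [← Fin.prod_univ_fun_getElem]
  exact Fintype.prod_equiv (finCongr (by simp)) _ _ fun x => rfl

variable {K K' L : Type*} {Ω : ℕ → Type*} [∀ N, MeasurableSpace (Ω N)]
  {P : ∀ N, Measure (Ω N)}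
  {Y : ∀ N, K → L → Matrix (Fin N) (Fin N) (Ω N → ℂ)}

open Classical in
/-- The covariance of a union of uncorrelated families. -/
noncomputable def unionCovariance (C : K → Matrix L L ℝ) (a b : K × L) : ℂ :=
  if a.1 = b.1 then (C a.1 a.2 b.2 : ℂ) else 0

theorem JointConditions.isIndependentSelfAdjoint {C : K → Matrix L L ℝ}
    (hY : ∀ k, IsSelfAdjointRandomFamily P (C k) (fun N => Y N k)) (hYj : JointConditions P Y)
    (N : ℕ) : IsIndependentSelfAdjoint (P N) (fun q : K × L => Y N q.1 q.2) where
  memLp q i j p hp := (hY q.1).memLp N q.2 i j p hp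
  mean_zero q i j := (hY q.1).mean_zero N q.2 i j
  selfAdjoint q i j := (hY q.1).selfAdjoint N q.2 i j
  indep := hYj.indep N

theorem JointConditions.covariance {C : K → Matrix L L ℝ}
    (hY : ∀ k, IsSelfAdjointRandomFamily P (C k) (fun N => Y N k)) (hYj : JointConditions P Y)
    (N : ℕ) (a b : K × L) (i j : Fin N) :
    ∫ ω, Y N a.1 a.2 i j ω * Y N b.1 b.2 j i ω ∂(P N) = unionCovariance C a b / N := by
  unfold unionCovariance
  split_ifs with h
  · rw [← h]
    exact (hY a.1).covariance N a.2 b.2 i j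
  · rw [zero_div]
    exact hYj.uncorrelated N a.1 b.1 a.2 b.2 i j h

theorem JointConditions.exists_bound (hYj : JointConditions P Y) (l : List (List (K × L))) :
    ∃ B : ℝ, 1 ≤ B ∧ ∃ N₀ : ℕ, ∀ N > N₀, ∀ (e : {e : Fin N × Fin N // e.1 ≤ e.2})
      (S : List ((K × L) × Fin N × Fin N)), (∀ s ∈ S, stepEdge s = e) → S.map Prod.fst ∈ l →
      ‖entryMoment (P N) (fun q : K × L => Y N q.1 q.2) S‖ ≤
        B * (N : ℝ) ^ (-(S.length : ℝ) / 2) := by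
  induction l with
  | nil => exact ⟨1, le_rfl, 0, by simp⟩
  | cons χ l ih =>
    obtain ⟨B, hB, N₀, h⟩ := ih
    obtain ⟨M, hM, N₁, h'⟩ := hYj.moment_bound χ.length (fun x => (χ.get x).2)
      (fun x => (χ.get x).1)
    refine ⟨max B M, hB.trans (le_max_left _ _), max N₀ N₁, fun N hN e S hS hl => ?_⟩
    rcases List.mem_cons.1 hl with hχ | hχ
    · have hlen : χ.length = S.length := by rw [← hχ, List.length_map]
      have h1 := h' N (lt_of_le_of_lt (le_max_right _ _) hN) e.1.1 e.1.2 e.2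
        (fun x => (S.get (x.cast hlen)).2.1) (fun x => (S.get (x.cast hlen)).2.2) (fun x => by
          have h2 := hS _ (S.get_mem (x.cast hlen))
          have h3 := stepEdge_cases (S.get (x.cast hlen))
          rw [h2] at h3
          rcases h3 with h3 | h3
          · exact Or.inl ⟨h3.1.symm, h3.2.symm⟩
          · exact Or.inr ⟨h3.2.symm, h3.1.symm⟩)
      rw [show (χ.length : ℝ) = S.length by rw [hlen]] at h1
      refine le_trans (le_of_eq ?_) (h1.trans ?_)
      · unfold entryMoment
        congr 2
        funext ω
        rw [prod_map_eq_prod_fin Prod.fst _ S hχ]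
        refine Finset.prod_congr rfl fun x _ => ?_
        have : (S.get (x.cast hlen)).1 = χ.get x := by
          subst hχ
          simp
        rw [this]
      · gcongr
        exact le_max_right _ _
    · refine (h N (lt_of_le_of_lt (le_max_left _ _) hN) e S hS hχ).trans ?_
      gcongr
      exact le_max_left _ _

variable [∀ N, IsProbabilityMeasure (P N)]

theorem JointConditions.exists_sublist_bound (hYj : JointConditions P Y) (χ : List (K × L)) :
    ∃ B : ℝ, 1 ≤ B ∧ ∃ N₀ : ℕ, ∀ N > N₀, ∀ (e : {e : Fin N × Fin N // e.1 ≤ e.2})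
      (S : List ((K × L) × Fin N × Fin N)), (∀ s ∈ S, stepEdge s = e) →
      (S.map Prod.fst).Sublist χ →
      ‖entryMoment (P N) (fun q : K × L => Y N q.1 q.2) S‖ ≤ (B / √N) ^ S.length := by
  obtain ⟨B, hB, N₀, h⟩ := hYj.exists_bound χ.sublists
  refine ⟨B, hB, N₀, fun N hN e S hS hl => ?_⟩
  rcases eq_or_ne S [] with rfl | hS0
  · simp [entryMoment_nil]
  · refine (h N hN e _ hS (List.mem_sublists.2 hl)).trans ?_
    set n := S.length with hn
    have hn0 : n ≠ 0 := by simpa [hn] using hS0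
    have hNpos : (0 : ℝ) ≤ N := Nat.cast_nonneg N
    have : (N : ℝ) ^ (-(n : ℝ) / 2) = ((√N) ^ n)⁻¹ := by
      rw [Real.sqrt_eq_rpow, ← Real.rpow_natCast, ← Real.rpow_mul hNpos, ← Real.rpow_neg hNpos]
      congr 1
      ring
    rw [this, div_pow, div_eq_mul_inv]
    gcongr
    exact le_self_pow₀ hB hn0

theorem word_eq_or {Q K' : Type*} (w : List (Q ⊕ K')) : (∃ l : List K', w = l.map Sum.inr) ∨
    ∃ (l : List K') (a : Q) (w' : List (Q ⊕ K')), w = l.map Sum.inr ++ Sum.inl a :: w' := by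
  induction w with
  | nil => exact Or.inl ⟨[], rfl⟩
  | cons x w ih =>
    rcases x with a | k
    · exact Or.inr ⟨[], a, w, rfl⟩
    · rcases ih with ⟨l, rfl⟩ | ⟨l, a, w', rfl⟩
      · exact Or.inl ⟨k :: l, rfl⟩
      · exact Or.inr ⟨k :: l, a, w', rfl⟩

theorem exists_norm_le_of_word {Q K' : Type*} {δ : ∀ N, K' → Fin N → ℂ}
    (hδ : ∀ k', ∃ M : ℝ, ∀ N i, ‖δ N k' i‖ ≤ M) (w : List (Q ⊕ K')) :
    ∃ D : ℝ, 1 ≤ D ∧ ∀ N k i, Sum.inr k ∈ w → ‖δ N k i‖ ≤ D := by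
  induction w with
  | nil => exact ⟨1, le_rfl, by simp⟩
  | cons x w ih =>
    obtain ⟨D, hD, h⟩ := ih
    rcases x with a | k
    · exact ⟨D, hD, fun N k i hk => h N k i (by simpa using hk)⟩
    · obtain ⟨M, hM⟩ := hδ k
      refine ⟨max D M, hD.trans (le_max_left _ _), fun N k' i hk => ?_⟩
      rcases List.mem_cons.1 hk with hk | hk
      · rw [Sum.inr.inj hk]
        exact (hM N i).trans (le_max_right _ _)
      · exact (h N k' i hk).trans (le_max_left _ _)

theorem JointConditions.tendsto_sub_splitSum {C : K → Matrix L L ℝ}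
    (hY : ∀ k, IsSelfAdjointRandomFamily P (C k) (fun N => Y N k)) (hYj : JointConditions P Y)
    {δ : ∀ N, K' → Fin N → ℂ} (hδ : ∀ k', ∃ M : ℝ, ∀ N i, ‖δ N k' i‖ ≤ M)
    (l : List K') (a : K × L) (w : List ((K × L) ⊕ K')) :
    Tendsto (fun N => wordMoment (P N) (fun q : K × L => Y N q.1 q.2) (δ N)
        (l.map Sum.inr ++ Sum.inl a :: w) - splitSum w fun u b v =>
      Sum.elim (fun q => unionCovariance C a q *
        wordMoment (P N) (fun q : K × L => Y N q.1 q.2) (δ N) u *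
        wordMoment (P N) (fun q : K × L => Y N q.1 q.2) (δ N) (l.map Sum.inr ++ v)) (fun _ => 0) b)
      atTop (𝓝 0) := by
  obtain ⟨B, hB, N₀, h⟩ := hYj.exists_sublist_bound (a :: leftLetters w)
  obtain ⟨D, hD, hD'⟩ := exists_norm_le_of_word hδ (l.map Sum.inr ++ Sum.inl a :: w)
  have hlim : Tendsto (fun N : ℕ => ((leftLetters w).length + 1) *
      B ^ ((leftLetters w).length + 1) * (D * (((leftLetters w).length + 2) / 2 + 1)) ^
        (l.map Sum.inr ++ Sum.inl a :: w).length * (√(N : ℝ))⁻¹) atTop (𝓝 0) := by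
    have h0 : Tendsto (fun N : ℕ => (√(N : ℝ))⁻¹) atTop (𝓝 0) := tendsto_inv_atTop_zero.comp
      (Real.tendsto_sqrt_atTop.comp tendsto_natCast_atTop_atTop)
    simpa only [mul_zero] using h0.const_mul (((leftLetters w).length + 1) *
      B ^ ((leftLetters w).length + 1) * (D * (((leftLetters w).length + 2) / 2 + 1)) ^
        (l.map Sum.inr ++ Sum.inl a :: w).length)
  refine squeeze_zero_norm' ?_ hlim
  filter_upwards [eventually_gt_atTop N₀] with N hN
  exact (hYj.isIndependentSelfAdjoint hY N).norm_sub_splitSum_le (δ N)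
    (hYj.covariance hY N) (by omega) l a w (by linarith) hD (hD' N) (h N hN)

/-- The joint moments converge, and the limits satisfy a recursion that determines them. -/
theorem JointConditions.exists_limit {C : K → Matrix L L ℝ}
    (hY : ∀ k, IsSelfAdjointRandomFamily P (C k) (fun N => Y N k)) (hYj : JointConditions P Y)
    {δ : ∀ N, K' → Fin N → ℂ} (hδ : ∀ k', ∃ M : ℝ, ∀ N i, ‖δ N k' i‖ ≤ M)
    {A : Type*} [Ring A] {φ : A → ℂ} {d : K' → A}
    (hd : ConvergesInDistribution
      (fun N => normTrace (N := N)) (fun N k' => Matrix.diagonal (δ N k')) φ d) :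
    ∃ m : List ((K × L) ⊕ K') → ℂ,
      (∀ w, Tendsto (fun N => wordMoment (P N) (fun q : K × L => Y N q.1 q.2) (δ N) w) atTop
        (𝓝 (m w))) ∧
      (∀ l : List K', m (l.map Sum.inr) = jointMoment φ d l) ∧
      (∀ (l : List K') (a : K × L) (w : List ((K × L) ⊕ K')),
        m (l.map Sum.inr ++ Sum.inl a :: w) = splitSum w fun u b v =>
          Sum.elim (fun q => unionCovariance C a q * m u * m (l.map Sum.inr ++ v))
            (fun _ => 0) b) ∧
      ∀ u v, m (u ++ v) = m (v ++ u) := by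
  set T : ℕ → List ((K × L) ⊕ K') → ℂ := fun N w =>
    wordMoment (P N) (fun q : K × L => Y N q.1 q.2) (δ N) w with hT
  have hbase : ∀ l : List K', Tendsto (fun N => T N (l.map Sum.inr)) atTop
      (𝓝 (jointMoment φ d l)) := by
    intro l
    refine (hd l).congr fun N => ?_
    exact ((hYj.isIndependentSelfAdjoint hY N).wordMoment_map_inr (δ N) l).symm
  have hstep : ∀ (m : List ((K × L) ⊕ K') → ℂ) (l : List K') (a : K × L)
      (w : List ((K × L) ⊕ K')),
      (∀ w' : List ((K × L) ⊕ K'),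
        w'.length < (l.map Sum.inr ++ Sum.inl a :: w : List ((K × L) ⊕ K')).length →
        Tendsto (fun N => T N w') atTop (𝓝 (m w'))) →
      Tendsto (fun N => T N (l.map Sum.inr ++ Sum.inl a :: w)) atTop
        (𝓝 (splitSum w fun u b v =>
          Sum.elim (fun q => unionCovariance C a q * m u * m (l.map Sum.inr ++ v))
            (fun _ => 0) b)) := by
    intro m l a w hm
    have h1 := hYj.tendsto_sub_splitSum hY hδ l a w
    have h2 : Tendsto (fun N => splitSum w fun u b v => Sum.elim (fun q => unionCovariance C a q *
        T N u * T N (l.map Sum.inr ++ v)) (fun _ => 0) b) atTop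
        (𝓝 (splitSum w fun u b v =>
          Sum.elim (fun q => unionCovariance C a q * m u * m (l.map Sum.inr ++ v))
            (fun _ => 0) b)) := by
      refine tendsto_splitSum fun u b v hw => ?_
      rcases b with q | k
      · simp only [Sum.elim_inl]
        refine ((hm u ?_).const_mul _).mul (hm _ ?_) <;> simp [hw] <;> omega
      · exact tendsto_const_nhds
    have h3 := h1.add h2
    rw [zero_add] at h3
    exact h3.congr fun N => sub_add_cancel _ _
  have hex : ∀ w, ∃ z, Tendsto (fun N => T N w) atTop (𝓝 z) := by
    intro w
    induction hn : w.length using Nat.strong_induction_on generalizing w with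
    | _ n ih =>
      rcases word_eq_or w with ⟨l, rfl⟩ | ⟨l, a, w', rfl⟩
      · exact ⟨_, hbase l⟩
      · classical
        have : ∀ w'' : List ((K × L) ⊕ K'), ∃ z, w''.length < n →
            Tendsto (fun N => T N w'') atTop (𝓝 z) := by
          intro w''
          by_cases h : w''.length < n
          · obtain ⟨z, hz⟩ := ih _ h w'' rfl
            exact ⟨z, fun _ => hz⟩
          · exact ⟨0, fun h' => absurd h' h⟩
        choose m hm using this
        exact ⟨_, hstep m l a w' fun w'' hw'' => hm w'' (hn ▸ hw'')⟩
  choose m hm using hex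
  refine ⟨m, hm, fun l => tendsto_nhds_unique (hm _) (hbase l),
    fun l a w => tendsto_nhds_unique (hm _) (hstep m l a w fun w' _ => hm w'), fun u v => ?_⟩
  refine tendsto_nhds_unique (hm _) ((hm (v ++ u)).congr fun N => ?_)
  exact (hYj.isIndependentSelfAdjoint hY N).wordMoment_comm (δ N) v u

end Limit

open scoped TensorProduct

section Algebra

theorem mem_adjoin_range_induction {α B : Type*} [Ring B] [Algebra ℂ B] (g : α → B) {p : B → Prop}
    (word : ∀ r : List α, p (r.map g).prod) (add : ∀ x y, p x → p y → p (x + y))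
    (smul : ∀ (z : ℂ) x, p x → p (z • x)) {x : B} (hx : x ∈ Algebra.adjoin ℂ (Set.range g)) :
    p x := by
  rw [← Subalgebra.mem_toSubmodule, Algebra.adjoin_eq_span] at hx
  induction hx using Submodule.span_induction with
  | mem x hx =>
    obtain ⟨l, hl, rfl⟩ := Submonoid.exists_list_of_mem_closure hx
    have : ∃ r : List α, r.map g = l := by
      clear hx
      induction l with
      | nil => exact ⟨[], rfl⟩
      | cons y l ih =>
        obtain ⟨a, ha⟩ := hl y List.mem_cons_self
        obtain ⟨r, hr⟩ := ih fun y hy => hl y (List.mem_cons_of_mem _ hy)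
        exact ⟨a :: r, by simp [ha, hr]⟩
    obtain ⟨r, rfl⟩ := this
    exact word r
  | zero => simpa using smul 0 _ (word [])
  | add x y _ _ hx hy => exact add x y hx hy
  | smul z x _ hx => exact smul z x hx

theorem list_prod_mem_adjoin_range {α B : Type*} [Ring B] [Algebra ℂ B] (g : α → B) (r : List α) :
    (r.map g).prod ∈ Algebra.adjoin ℂ (Set.range g) := by
  refine list_prod_mem fun x hx => ?_
  obtain ⟨a, _, rfl⟩ := List.mem_map.1 hx
  exact Algebra.subset_adjoin ⟨a, rfl⟩

/-- Two linear functionals for which the same subalgebras are free agree on the products of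
elements of these subalgebras, if they agree on each of the subalgebras. -/
theorem IsFree.eq_on_products {ι B : Type*} [Ring B] [Algebra ℂ B] {S : ι → Subalgebra ℂ B}
    {μ₁ μ₂ : B →ₗ[ℂ] ℂ} (h₁ : IsFree μ₁ S) (h₂ : IsFree μ₂ S) (hone : μ₁ 1 = 1)
    (hone' : μ₂ 1 = 1)
    (heq : ∀ i, ∀ x ∈ S i, μ₁ x = μ₂ x) (T : List (ι × B)) (hT : ∀ x ∈ T, x.2 ∈ S x.1) :
    μ₁ (T.map Prod.snd).prod = μ₂ (T.map Prod.snd).prod := by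
  induction hn : T.length using Nat.strong_induction_on generalizing T with
  | _ n ih =>
    by_cases hn0 : n = 0
    · have : T = [] := List.length_eq_zero_iff.1 (by omega)
      subst this
      simp [hone, hone']
    suffices H : ∀ T₂ T₁ : List (ι × B), (T₁ ++ T₂).length = n →
        (∀ x ∈ T₁ ++ T₂, x.2 ∈ S x.1) → (∀ x ∈ T₁, μ₁ x.2 = 0) →
        μ₁ ((T₁ ++ T₂).map Prod.snd).prod = μ₂ ((T₁ ++ T₂).map Prod.snd).prod from
      H T [] hn hT (by simp)
    intro T₂
    induction T₂ with
    | nil =>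
      intro T₁ hlen hmem hcent
      rw [List.append_nil] at *
      by_cases hchain : T₁.IsChain (fun x y => x.1 ≠ y.1)
      · have hne : T₁ ≠ [] := by rintro rfl; exact hn0 hlen.symm
        rw [h₁ T₁ hne hchain fun x hx => ⟨hmem x hx, hcent x hx⟩,
          h₂ T₁ hne hchain fun x hx => ⟨hmem x hx, by
            rw [← heq x.1 x.2 (hmem x hx)]; exact hcent x hx⟩]
      · obtain ⟨A, x, y, Z, rfl, hxy⟩ : ∃ A x y Z, T₁ = A ++ x :: y :: Z ∧ x.1 = y.1 := by
          rw [List.isChain_iff_forall_rel_of_append_cons_cons] at hchain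
          push Not at hchain
          obtain ⟨x, y, A, Z, h, hxy⟩ := hchain
          exact ⟨A, x, y, Z, h, hxy⟩
        have := ih (n - 1) (by omega) (A ++ (x.1, x.2 * y.2) :: Z) (by
            intro z hz
            simp only [List.mem_append, List.mem_cons] at hz
            rcases hz with hz | rfl | hz
            · exact hmem z (by simp [hz])
            · exact mul_mem (hmem x (by simp)) (by
                show y.2 ∈ S x.1
                rw [hxy]; exact hmem y (by simp))
            · exact hmem z (by simp [hz])) (by simp at hlen ⊢; omega)
        simpa [mul_assoc] using this
    | cons b T₂ ih₂ =>
      intro T₁ hlen hmem hcent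
      have hb := hmem b (by simp)
      set z := μ₁ b.2 with hz
      have e1 := ih₂ (T₁ ++ [(b.1, b.2 - algebraMap ℂ B z)]) (by simpa using hlen) (by
          intro x hx
          simp only [List.append_assoc, List.mem_append, List.mem_cons,
            List.cons_append, List.nil_append] at hx
          rcases hx with hx | rfl | hx
          · exact hmem x (by simp [hx])
          · exact sub_mem hb (algebraMap_mem _ _)
          · exact hmem x (by simp [hx])) (by
          intro x hx
          rcases List.mem_append.1 hx with hx | hx
          · exact hcent x hx
          · rw [List.mem_singleton.1 hx]
            simp [Algebra.algebraMap_eq_smul_one, hone, hz])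
      have e2 := ih (n - 1) (by omega) (T₁ ++ T₂) (fun x hx => hmem x (by
          simp only [List.mem_append, List.mem_cons] at hx ⊢; tauto)) (by simp at hlen ⊢; omega)
      have key : ((T₁ ++ b :: T₂).map Prod.snd).prod =
          ((T₁ ++ [(b.1, b.2 - algebraMap ℂ B z)] ++ T₂).map Prod.snd).prod +
            z • ((T₁ ++ T₂).map Prod.snd).prod := by
        simp only [List.append_assoc, List.cons_append, List.nil_append, List.map_append,
          List.map_cons, List.prod_append, List.prod_cons, Algebra.algebraMap_eq_smul_one, sub_mul,
          mul_sub, smul_mul_assoc, one_mul, mul_smul_comm]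
        abel
      rw [key, map_add, map_add, map_smul, map_smul, e1, e2]

/-- The image of free subalgebras under a homomorphism. -/
theorem IsFree.comp {ι B B' : Type*} [Ring B] [Algebra ℂ B] [Ring B'] [Algebra ℂ B']
    {S : ι → Subalgebra ℂ B} {S' : ι → Subalgebra ℂ B'} {ψ : B' → ℂ} (h : IsFree ψ S')
    (η : B →ₐ[ℂ] B') (hS : ∀ i, ∀ x ∈ S i, η x ∈ S' i) : IsFree (fun x => ψ (η x)) S := by
  intro w hne hchain hw
  have := h (w.map fun x => (x.1, η x.2)) (by simpa using hne)
    (List.isChain_map _ |>.2 hchain) (by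
      intro x hx
      obtain ⟨y, hy, rfl⟩ := List.mem_map.1 hx
      exact ⟨hS _ _ (hw y hy).1, (hw y hy).2⟩)
  show ψ (η _) = 0
  rw [map_list_prod, List.map_map]
  rwa [List.map_map] at this

variable {X : Type*}

theorem freeAlgebra_word_induction {p : FreeAlgebra ℂ X → Prop}
    (word : ∀ r : List X, p (r.map (FreeAlgebra.ι ℂ)).prod) (add : ∀ x y, p x → p y → p (x + y))
    (smul : ∀ (z : ℂ) x, p x → p (z • x)) (x : FreeAlgebra ℂ X) : p x :=
  mem_adjoin_range_induction (FreeAlgebra.ι ℂ) word add smul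
    (by rw [FreeAlgebra.adjoin_range_ι]; trivial)

/-- The linear functional on the free algebra with given values on the words. -/
noncomputable def wordFunctional (m : List X → ℂ) : FreeAlgebra ℂ X →ₗ[ℂ] ℂ :=
  (FreeAlgebra.basisFreeMonoid ℂ X).constr ℂ fun w => m w.toList

theorem wordFunctional_word (m : List X → ℂ) (w : List X) :
    wordFunctional m (w.map (FreeAlgebra.ι ℂ)).prod = m w := by
  have h : (w.map (FreeAlgebra.ι ℂ)).prod =
      FreeAlgebra.basisFreeMonoid ℂ X (FreeMonoid.ofList w) := by
    simp [FreeAlgebra.basisFreeMonoid, FreeAlgebra.equivMonoidAlgebraFreeMonoid]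
  rw [h, wordFunctional, Module.Basis.constr_basis]
  rfl

end Algebra

section Derivation
variable {X : Type*}

/-- The free difference quotient, weighted by the numbers `c x`, as the entry in the corner of a
homomorphism into the upper triangular matrices. -/
noncomputable def diffMatrix (c : X → ℂ) : FreeAlgebra ℂ X →ₐ[ℂ]
    Matrix (Fin 2) (Fin 2) (FreeAlgebra ℂ X ⊗[ℂ] FreeAlgebra ℂ X) :=
  FreeAlgebra.lift ℂ fun x =>
    !![FreeAlgebra.ι ℂ x ⊗ₜ 1, c x • (1 ⊗ₜ 1); 0, 1 ⊗ₜ FreeAlgebra.ι ℂ x]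

theorem diffMatrix_diag (c : X → ℂ) (x : FreeAlgebra ℂ X) :
    diffMatrix c x 0 0 = x ⊗ₜ 1 ∧ diffMatrix c x 1 0 = 0 ∧ diffMatrix c x 1 1 = 1 ⊗ₜ x := by
  induction x using FreeAlgebra.induction with
  | grade0 r =>
    rw [AlgHom.commutes]
    simp [Matrix.algebraMap_matrix_apply,
      Algebra.algebraMap_eq_smul_one, TensorProduct.smul_tmul, Algebra.TensorProduct.one_def]
  | grade1 x => simp [diffMatrix]
  | mul x y hx hy =>
    simp [Matrix.mul_apply, Fin.sum_univ_two, hx, hy]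
  | add x y hx hy =>
    simp [hx, hy, TensorProduct.add_tmul, TensorProduct.tmul_add]

/-- The free difference quotient `∂`, with `∂ x = c x • 1 ⊗ 1` for the generators `x`. -/
noncomputable def freeDiff (c : X → ℂ) :
    FreeAlgebra ℂ X →ₗ[ℂ] FreeAlgebra ℂ X ⊗[ℂ] FreeAlgebra ℂ X where
  toFun x := diffMatrix c x 0 1
  map_add' x y := by simp
  map_smul' z x := by simp

theorem freeDiff_mul (c : X → ℂ) (x y : FreeAlgebra ℂ X) :
    freeDiff c (x * y) = (x ⊗ₜ 1) * freeDiff c y + freeDiff c x * (1 ⊗ₜ y) := by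
  simp [freeDiff, Matrix.mul_apply, Fin.sum_univ_two, diffMatrix_diag]

theorem freeDiff_one (c : X → ℂ) : freeDiff c (1 : FreeAlgebra ℂ X) = 0 := by
  simp [freeDiff]

theorem freeDiff_ι (c : X → ℂ) (x : X) :
    freeDiff c (FreeAlgebra.ι ℂ x) = c x • (1 ⊗ₜ 1) := by
  simp [freeDiff, diffMatrix]

theorem freeDiff_word {α : Type*} (c : X → ℂ) (g : α → X) (r : List α) :
    freeDiff c (r.map fun a => FreeAlgebra.ι ℂ (g a)).prod = splitSum r fun u b v =>
      c (g b) • ((u.map fun a => FreeAlgebra.ι ℂ (g a)).prod ⊗ₜ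
        (v.map fun a => FreeAlgebra.ι ℂ (g a)).prod) := by
  induction r with
  | nil => simp [splitSum, freeDiff_one]
  | cons b r ih =>
    rw [List.map_cons, List.prod_cons, freeDiff_mul, ih, freeDiff_ι, splitSum, splitSum_mul_left,
      add_comm]
    congr 1
    · rw [smul_mul_assoc, Algebra.TensorProduct.tmul_mul_tmul]; simp
    · refine splitSum_congr fun u b v _ => ?_
      rw [mul_smul_comm, Algebra.TensorProduct.tmul_mul_tmul]; simp

/-- The functional `x ⊗ y ↦ μ x * μ y`. -/
noncomputable def tensorSquare (μ : FreeAlgebra ℂ X →ₗ[ℂ] ℂ) :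
    FreeAlgebra ℂ X ⊗[ℂ] FreeAlgebra ℂ X →ₗ[ℂ] ℂ :=
  LinearMap.mul' ℂ ℂ ∘ₗ TensorProduct.map μ μ

@[simp] theorem tensorSquare_tmul (μ : FreeAlgebra ℂ X →ₗ[ℂ] ℂ) (x y : FreeAlgebra ℂ X) :
    tensorSquare μ (x ⊗ₜ y) = μ x * μ y := by simp [tensorSquare]

theorem tensorSquare_freeDiff_word (μ : FreeAlgebra ℂ X →ₗ[ℂ] ℂ) {α : Type*} (c : X → ℂ)
    (g : α → X) (r : List α) (R P Z : FreeAlgebra ℂ X) :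
    tensorSquare μ ((R ⊗ₜ P) *
      (freeDiff c (r.map fun a => FreeAlgebra.ι ℂ (g a)).prod * (1 ⊗ₜ Z))) =
    splitSum r fun u b v => c (g b) * (μ (R * (u.map fun a => FreeAlgebra.ι ℂ (g a)).prod) *
        μ (P * ((v.map fun a => FreeAlgebra.ι ℂ (g a)).prod * Z))) := by
  have := splitSum_map ((tensorSquare μ ∘ₗ LinearMap.mulLeft ℂ (R ⊗ₜ P) ∘ₗ
    LinearMap.mulRight ℂ ((1 : FreeAlgebra ℂ X) ⊗ₜ Z)).toAddMonoidHom) r fun u b v =>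
      c (g b) • ((u.map fun a => FreeAlgebra.ι ℂ (g a)).prod ⊗ₜ[ℂ]
        (v.map fun a => FreeAlgebra.ι ℂ (g a)).prod)
  rw [freeDiff_word]
  simpa using this

end Derivation

section Freeness
variable {K K' L : Type*}

/-- The subalgebras generated by the families of letters. -/
noncomputable def letterSubalgebra (o : Option K) :
    Subalgebra ℂ (FreeAlgebra ℂ ((K × L) ⊕ K')) :=
  o.elim (Algebra.adjoin ℂ (Set.range fun k' => FreeAlgebra.ι ℂ (Sum.inr k')))
    (fun k => Algebra.adjoin ℂ (Set.range fun l => FreeAlgebra.ι ℂ (Sum.inl (k, l))))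

/-- The recursion of Schwinger and Dyson for a functional on the free algebra: `c a b` is the
covariance of the letters `a` and `b`, different families are uncorrelated, and the other letters
are not paired. -/
structure IsSchwingerDyson (μ : FreeAlgebra ℂ ((K × L) ⊕ K') →ₗ[ℂ] ℂ)
    (c : K × L → K × L → ℂ) : Prop where
  one : μ 1 = 1
  uncorrelated : ∀ a b, a.1 ≠ b.1 → c a b = 0
  recursion : ∀ P ∈ letterSubalgebra (K := K) (K' := K') (L := L) none, ∀ (a : K × L) W,
    μ (P * (FreeAlgebra.ι ℂ (Sum.inl a) * W)) =
      tensorSquare μ ((1 ⊗ₜ P) * freeDiff (Sum.elim (c a) fun _ => 0) W)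

/-- Alternating products of centred elements. -/
structure IsAlternating (μ : FreeAlgebra ℂ ((K × L) ⊕ K') →ₗ[ℂ] ℂ)
    (T : List (Option K × FreeAlgebra ℂ ((K × L) ⊕ K'))) : Prop where
  chain : T.IsChain (fun x y => x.1 ≠ y.1)
  mem : ∀ x ∈ T, x.2 ∈ letterSubalgebra x.1
  centred : ∀ x ∈ T, μ x.2 = 0

variable {μ : FreeAlgebra ℂ ((K × L) ⊕ K') →ₗ[ℂ] ℂ} {c : K × L → K × L → ℂ}

theorem IsSchwingerDyson.tensorSquare_block_eq_zero (h : IsSchwingerDyson μ c) {o : Option K}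
    {y : FreeAlgebra ℂ ((K × L) ⊕ K')} (hy : y ∈ letterSubalgebra o) (a : K × L)
    (R P Z : FreeAlgebra ℂ ((K × L) ⊕ K'))
    (H : o = some a.1 → ∀ u ∈ letterSubalgebra (K' := K') (L := L) o, μ (R * u) = 0) :
    tensorSquare μ ((R ⊗ₜ P) * (freeDiff (Sum.elim (c a) fun _ => 0) y * (1 ⊗ₜ Z))) = 0 := by
  rcases o with _ | k
  · refine mem_adjoin_range_induction (p := fun y => tensorSquare μ ((R ⊗ₜ P) *
      (freeDiff (Sum.elim (c a) fun _ => 0) y * (1 ⊗ₜ Z))) = 0) _ (fun r => ?_)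
      (fun x y hx hy => ?_) (fun z x hx => ?_) hy
    · rw [tensorSquare_freeDiff_word]
      exact splitSum_eq_zero fun u b v _ => by simp
    · rw [map_add, add_mul, mul_add, map_add, hx, hy, add_zero]
    · rw [map_smul, smul_mul_assoc, mul_smul_comm, map_smul, hx, smul_zero]
  · refine mem_adjoin_range_induction (p := fun y => tensorSquare μ ((R ⊗ₜ P) *
      (freeDiff (Sum.elim (c a) fun _ => 0) y * (1 ⊗ₜ Z))) = 0) _ (fun r => ?_)
      (fun x y hx hy => ?_) (fun z x hx => ?_) hy
    · rw [tensorSquare_freeDiff_word]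
      refine splitSum_eq_zero fun u b v _ => ?_
      by_cases hk : k = a.1
      · rw [H (by rw [hk]) _ (list_prod_mem_adjoin_range _ u)]
        simp
      · have : c a (k, b) = 0 := h.uncorrelated _ _ fun h => hk h.symm
        simp [this]
    · rw [map_add, add_mul, mul_add, map_add, hx, hy, add_zero]
    · rw [map_smul, smul_mul_assoc, mul_smul_comm, map_smul, hx, smul_zero]

theorem IsSchwingerDyson.tensorSquare_product_eq_zero (h : IsSchwingerDyson μ c) (a : K × L)
    (T : List (Option K × FreeAlgebra ℂ ((K × L) ⊕ K'))) (hT : ∀ x ∈ T, x.2 ∈ letterSubalgebra x.1)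
    (R P : FreeAlgebra ℂ ((K × L) ⊕ K'))
    (H : ∀ T₁ y T₂, T = T₁ ++ (some a.1, y) :: T₂ →
      ∀ u ∈ letterSubalgebra (K' := K') (L := L) (some a.1),
        μ (R * ((T₁.map Prod.snd).prod * u)) = 0) :
    tensorSquare μ ((R ⊗ₜ P) *
      freeDiff (Sum.elim (c a) fun _ => 0) (T.map Prod.snd).prod) = 0 := by
  induction T generalizing R with
  | nil => simp [freeDiff_one]
  | cons x T ih =>
    rw [List.map_cons, List.prod_cons, freeDiff_mul, mul_add, map_add, ← mul_assoc,
      Algebra.TensorProduct.tmul_mul_tmul, mul_one, ih, zero_add]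
    · refine h.tensorSquare_block_eq_zero (hT x (by simp)) a R P _ fun hx u hu => ?_
      have := H [] x.2 T (by rw [← hx]; rfl) u (hx ▸ hu)
      simpa using this
    · exact fun y hy => hT y (by simp [hy])
    · rintro T₁ y T₂ rfl u hu
      have := H (x :: T₁) y T₂ rfl u hu
      simpa [mul_assoc] using this

theorem IsSchwingerDyson.recursion_word (h : IsSchwingerDyson μ c) (k : K) (l : L) (r : List L) :
    μ ((l :: r).map fun l => FreeAlgebra.ι ℂ (Sum.inl (k, l) : (K × L) ⊕ K')).prod =
      splitSum r fun u b v => c (k, l) (k, b) *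
        (μ (u.map fun l => FreeAlgebra.ι ℂ (Sum.inl (k, l) : (K × L) ⊕ K')).prod *
         μ (v.map fun l => FreeAlgebra.ι ℂ (Sum.inl (k, l) : (K × L) ⊕ K')).prod) := by
  have h1 := h.recursion 1 (one_mem _) (k, l)
    (r.map fun l => FreeAlgebra.ι ℂ (Sum.inl (k, l) : (K × L) ⊕ K')).prod
  have h2 := tensorSquare_freeDiff_word μ (Sum.elim (c (k, l)) fun _ => 0)
    (fun l => (Sum.inl (k, l) : (K × L) ⊕ K')) r 1 1 1
  rw [← Algebra.TensorProduct.one_def, mul_one, one_mul] at h2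
  rw [← Algebra.TensorProduct.one_def, one_mul, one_mul, h2] at h1
  rw [List.map_cons, List.prod_cons, h1]
  simp

theorem IsSchwingerDyson.centred_word_eq_zero (h : IsSchwingerDyson μ c) {n : ℕ}
    (ih : ∀ T, T.length < n → T ≠ [] → IsAlternating μ T → μ (T.map Prod.snd).prod = 0)
    (k : K) (r : List L)
    (P : FreeAlgebra ℂ ((K × L) ⊕ K')) (hP : P ∈ letterSubalgebra (K := K) (K' := K') (L := L) none)
    (T : List (Option K × FreeAlgebra ℂ ((K × L) ⊕ K'))) (hT : IsAlternating μ T)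
    (hhead : ∀ x ∈ T.head?, x.1 ≠ some k) (hlen : T.length < n) :
    μ (P * ((r.map fun l => FreeAlgebra.ι ℂ (Sum.inl (k, l))).prod * (T.map Prod.snd).prod)) =
      μ (r.map fun l => FreeAlgebra.ι ℂ (Sum.inl (k, l) : (K × L) ⊕ K')).prod *
        μ (P * (T.map Prod.snd).prod) := by
  induction hr : r.length using Nat.strong_induction_on generalizing r P T with
  | _ N ihr =>
    rcases r with _ | ⟨l, r⟩
    · simp [h.one]
    rw [h.recursion_word, List.map_cons, List.prod_cons, mul_assoc, h.recursion P hP, freeDiff_mul,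
      mul_add, map_add, ← mul_assoc, Algebra.TensorProduct.tmul_mul_tmul, mul_one, one_mul,
      h.tensorSquare_product_eq_zero _ T hT.mem, zero_add, tensorSquare_freeDiff_word,
      mul_comm (splitSum r _), splitSum_mul_left]
    · refine splitSum_congr fun u b v huv => ?_
      rw [ihr v.length (by rw [← hr, huv]; simp; omega) v P hP T hT hhead hlen rfl]
      simp only [one_mul, Sum.elim_inl]
      ring
    · rintro T₁ y T₂ rfl u hu
      set w : FreeAlgebra ℂ ((K × L) ⊕ K') :=
        (r.map fun l => FreeAlgebra.ι ℂ (Sum.inl (k, l))).prod with hw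
      set u₀ := u - algebraMap ℂ _ (μ u) with hu₀
      have hne : T₁ ≠ [] := by
        rintro rfl
        exact hhead (some k, y) (by simp) rfl
      have halt₁ : IsAlternating μ T₁ := ⟨(List.isChain_append.1 hT.chain).1,
        fun x hx => hT.mem x (by simp [hx]), fun x hx => hT.centred x (by simp [hx])⟩
      have halt₂ : IsAlternating μ (T₁ ++ [(some k, u₀)]) := by
        refine ⟨?_, fun x hx => ?_, fun x hx => ?_⟩
        · have hc := List.isChain_append.1 hT.chain
          refine List.isChain_append.2 ⟨hc.1, List.isChain_singleton _, fun x hx z hz => ?_⟩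
          have := hc.2.2 x hx (some k, y) (by simp)
          simp only [List.head?_cons, Option.mem_some_iff] at hz
          rw [← hz]
          exact this
        · rcases List.mem_append.1 hx with hx | hx
          · exact halt₁.mem x hx
          · rw [List.mem_singleton.1 hx]
            exact sub_mem hu (algebraMap_mem _ _)
        · rcases List.mem_append.1 hx with hx | hx
          · exact halt₁.centred x hx
          · rw [List.mem_singleton.1 hx]
            simp [hu₀, Algebra.algebraMap_eq_smul_one, h.one]
      have hh : ∀ Z, ∀ x ∈ (T₁ ++ Z).head?, x.1 ≠ some k := by
        intro Z x hx
        refine hhead x ?_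
        rcases T₁ with _ | ⟨z, T₁⟩
        · exact absurd rfl hne
        · exact hx
      have hlen' : T₁.length + 1 < n := by simp at hlen; omega
      have e1 := ihr r.length (by rw [← hr]; simp) r 1 (one_mem _) T₁ halt₁
        (by simpa using hh []) (by omega) rfl
      have e2 := ihr r.length (by rw [← hr]; simp) r 1 (one_mem _) _ halt₂ (hh _)
        (by simp; omega) rfl
      have e3 := ih T₁ (by omega) hne halt₁
      have e4 := ih _ (by simp; omega) (by simp) halt₂
      rw [one_mul, one_mul, e3, mul_zero] at e1
      rw [one_mul, one_mul, e4, mul_zero] at e2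
      have key : w * ((T₁.map Prod.snd).prod * u) =
          w * ((T₁ ++ [(some k, u₀)]).map Prod.snd).prod + μ u • (w * (T₁.map Prod.snd).prod) := by
        simp [hu₀, Algebra.algebraMap_eq_smul_one, mul_sub]
      rw [key, map_add, map_smul, e1, e2]
      simp

theorem IsSchwingerDyson.isFree (h : IsSchwingerDyson μ c) :
    IsFree μ (letterSubalgebra : Option K → Subalgebra ℂ (FreeAlgebra ℂ ((K × L) ⊕ K'))) := by
  suffices H : ∀ n, ∀ T : List (Option K × FreeAlgebra ℂ ((K × L) ⊕ K')), T.length = n → T ≠ [] →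
      IsAlternating μ T → μ (T.map Prod.snd).prod = 0 from
    fun T hne hchain hT => H _ T rfl hne ⟨hchain, fun x hx => (hT x hx).1, fun x hx => (hT x hx).2⟩
  intro n
  induction n using Nat.strong_induction_on with
  | _ n ih =>
    have ih' : ∀ T : List (Option K × FreeAlgebra ℂ ((K × L) ⊕ K')), T.length < n → T ≠ [] →
      IsAlternating μ T → μ (T.map Prod.snd).prod = 0 := fun T hT => ih _ hT T rfl
    have key : ∀ (k : K) (x P : FreeAlgebra ℂ ((K × L) ⊕ K'))
        (T : List (Option K × FreeAlgebra ℂ ((K × L) ⊕ K'))), x ∈ letterSubalgebra (some k) →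
        μ x = 0 → P ∈ letterSubalgebra (K := K) (K' := K') (L := L) none → IsAlternating μ T →
        (∀ x ∈ T.head?, x.1 ≠ some k) → T.length < n →
        μ (P * (x * (T.map Prod.snd).prod)) = 0 := by
      intro k x P T hx hμx hP hT hhead hlen
      have : μ (P * (x * (T.map Prod.snd).prod)) = μ x * μ (P * (T.map Prod.snd).prod) := by
        refine mem_adjoin_range_induction (p := fun x =>
          μ (P * (x * (T.map Prod.snd).prod)) = μ x * μ (P * (T.map Prod.snd).prod)) _
          (fun r => ?_) (fun x y hx hy => ?_) (fun z x hx => ?_) hx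
        · exact h.centred_word_eq_zero ih' k r P hP T hT hhead hlen
        · rw [add_mul, mul_add, map_add, hx, hy, map_add, add_mul]
        · rw [smul_mul_assoc, mul_smul_comm, map_smul, hx, map_smul, smul_eq_mul, smul_eq_mul,
            mul_assoc]
      rw [this, hμx, zero_mul]
    have tail : ∀ x T, IsAlternating μ (x :: T) → IsAlternating μ T ∧
        ∀ y ∈ T.head?, y.1 ≠ x.1 := by
      intro x T hT
      obtain ⟨h1, h2⟩ := List.isChain_cons.1 hT.chain
      exact ⟨⟨h2, fun y hy => hT.mem y (by simp [hy]), fun y hy => hT.centred y (by simp [hy])⟩,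
        fun y hy => (h1 y hy).symm⟩
    rintro (_ | ⟨⟨_ | k, x⟩, T⟩) hlen hne hT
    · exact absurd rfl hne
    · rcases T with _ | ⟨⟨_ | k, y⟩, T⟩
      · simpa using hT.centred _ List.mem_cons_self
      · exact absurd rfl ((tail _ _ hT).2 (none, y) rfl)
      · have hT' := tail _ _ (tail _ _ hT).1
        simp only [List.map_cons, List.prod_cons]
        exact key k y x T (hT.mem (some k, y) (by simp)) (hT.centred (some k, y) (by simp))
          (hT.mem (none, x) (by simp)) hT'.1 hT'.2 (by simp at hlen; omega)
    · have hT' := tail _ _ hT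
      have := key k x 1 T (hT.mem (some k, x) (by simp)) (hT.centred (some k, x) (by simp))
        (one_mem _) hT'.1 hT'.2 (by simp at hlen; omega)
      simpa using this

end Freeness

section Semicircular
variable {L : Type*}

theorem drop_take_eq_nil {n : ℕ} (i : Fin n → L) {a b : ℕ} (h : b ≤ a) :
    ((List.ofFn i).take b).drop a = [] := by
  apply List.drop_eq_nil_of_le
  simp
  omega

theorem drop_take_eq_cons {n : ℕ} (i : Fin n → L) {a b : ℕ} (hab : a < b) (hb : b ≤ n) :
    ((List.ofFn i).take b).drop a =
      i ⟨a, by omega⟩ :: ((List.ofFn i).take b).drop (a + 1) := by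
  rw [List.drop_eq_getElem_cons (by simp; omega)]
  simp

theorem splitSum_drop_take {M : Type*} [AddCommMonoid M] {n : ℕ} (i : Fin n → L) {b : ℕ}
    (hb : b ≤ n) (a : ℕ) (g : List L → L → List L → M) :
    splitSum (((List.ofFn i).take b).drop a) g = ∑ j : Fin n, if a ≤ j.1 ∧ j.1 < b then
      g (((List.ofFn i).take j).drop a) (i j) (((List.ofFn i).take b).drop (j + 1)) else 0 := by
  induction hk : b - a generalizing a g with
  | zero =>
    rw [drop_take_eq_nil i (by omega), splitSum, Finset.sum_eq_zero]
    intro j _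
    rw [if_neg (by omega)]
  | succ k ih =>
    have hab : a < b := by omega
    rw [drop_take_eq_cons i hab hb, splitSum, ih (a + 1) _ (by omega)]
    set G : Fin n → M := fun j =>
      g (((List.ofFn i).take j).drop a) (i j) (((List.ofFn i).take b).drop (j + 1)) with hG
    have h1 : ∀ j : Fin n, (if a ≤ j.1 ∧ j.1 < b then G j else 0) =
        (if j = ⟨a, by omega⟩ then G j else 0) + if a + 1 ≤ j.1 ∧ j.1 < b then G j else 0 := by
      intro j
      by_cases hj : j = ⟨a, by omega⟩
      · subst hj
        simp [hab]
      · have : j.1 ≠ a := fun h => hj (Fin.ext h)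
        rw [if_neg hj, zero_add]
        congr 1
        apply propext
        omega
    rw [Finset.sum_congr rfl fun j _ => h1 j, Finset.sum_add_distrib, Finset.sum_ite_eq',
      if_pos (Finset.mem_univ _)]
    congr 1
    · rw [hG]
      simp only [drop_take_eq_nil i le_rfl]
    · refine Finset.sum_congr rfl fun j _ => ?_
      split_ifs with hj
      · rw [hG]
        simp only
        rw [drop_take_eq_cons i (a := a) (b := j) (by omega) (by omega)]
      · rfl

/-- A functional on words that satisfies the recursion of the semicircular families is the sum
over the non-crossing pairings. -/
theorem eq_ncSum_of_recursion {ν : List L → ℂ} {c : L → L → ℂ} (h0 : ν [] = 1)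
    (hrec : ∀ a w, ν (a :: w) = splitSum w fun u b v => c a b * (ν u * ν v))
    {n : ℕ} (i : Fin n → L) :
    ν (List.ofFn i) = ncSum (fun p q => c (i p) (i q)) 0 n := by
  suffices H : ∀ k a b, b ≤ n → b - a = k →
      ν (((List.ofFn i).take b).drop a) = ncSum (fun p q => c (i p) (i q)) a b by
    have := H n 0 n le_rfl rfl
    rwa [List.drop_zero, List.take_of_length_le (by simp)] at this
  intro k
  induction k using Nat.strong_induction_on with
  | _ k ih =>
    intro a b hb hk
    rcases Nat.lt_or_ge a b with hab | hab
    · have h1 := ncSum_recursion (fun p q => c (i p) (i q)) (⟨a, by omega⟩ : Fin n) b hab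
      rw [drop_take_eq_cons i hab hb, hrec, splitSum_drop_take i hb, h1]
      refine Finset.sum_congr rfl fun j _ => ?_
      have hiff : (a + 1 ≤ j.1 ∧ j.1 < b) ↔ ((⟨a, by omega⟩ : Fin n) < j ∧ j.1 < b) := by
        rw [Fin.lt_def]
        exact Iff.rfl
      simp only [hiff]
      split_ifs with hj
      · have hj' := hiff.2 hj
        rw [ih (j - (a + 1)) (by omega) (a + 1) j (by omega) rfl,
          ih (b - (j + 1)) (by omega) (j + 1) b hb rfl, mul_assoc]
      · rfl
    · rw [drop_take_eq_nil i hab, h0, ncSum_of_le _ hab]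

end Semicircular

section Main
variable {K K' L : Type*}

/-- The functional on the free algebra with given moments satisfies the recursion of Schwinger and
Dyson if its moments do. -/
theorem isSchwingerDyson_wordFunctional {m : List ((K × L) ⊕ K') → ℂ} {c : K × L → K × L → ℂ}
    (hone : m [] = 1) (hunc : ∀ a b, a.1 ≠ b.1 → c a b = 0)
    (hrec : ∀ (l : List K') (a : K × L) (w : List ((K × L) ⊕ K')),
      m (l.map Sum.inr ++ Sum.inl a :: w) = splitSum w fun u b v =>
        Sum.elim (fun q => c a q * m u * m (l.map Sum.inr ++ v)) (fun _ => 0) b) :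
    IsSchwingerDyson (wordFunctional m) c where
  one := by simpa [hone] using wordFunctional_word m []
  uncorrelated := hunc
  recursion := by
    intro P hP a W
    refine mem_adjoin_range_induction (p := fun P => wordFunctional m
      (P * (FreeAlgebra.ι ℂ (Sum.inl a) * W)) = tensorSquare (wordFunctional m)
        ((1 ⊗ₜ P) * freeDiff (Sum.elim (c a) fun _ => 0) W)) _ (fun l => ?_)
      (fun x y hx hy => ?_) (fun z x hx => ?_) hP
    · refine freeAlgebra_word_induction (p := fun W => wordFunctional m
        (_ * (FreeAlgebra.ι ℂ (Sum.inl a) * W)) = tensorSquare (wordFunctional m)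
          ((1 ⊗ₜ _) * freeDiff (Sum.elim (c a) fun _ => 0) W))
        (fun w => ?_) (fun x y hx hy => ?_) (fun z x hx => ?_) W
      · have h1 := tensorSquare_freeDiff_word (wordFunctional m) (Sum.elim (c a) fun _ => 0) id w 1
          (l.map fun k' => FreeAlgebra.ι ℂ (Sum.inr k')).prod 1
        rw [← Algebra.TensorProduct.one_def, mul_one] at h1
        have h2 := wordFunctional_word m (l.map Sum.inr ++ Sum.inl a :: w)
        rw [List.map_append, List.map_map, List.map_cons, List.prod_append, List.prod_cons] at h2
        refine h2.trans (Eq.trans ?_ h1.symm)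
        rw [hrec]
        refine splitSum_congr fun u b v _ => ?_
        rcases b with q | k'
        · have h3 := wordFunctional_word m (l.map Sum.inr ++ v)
          rw [List.map_append, List.map_map, List.prod_append] at h3
          rw [← h3, ← wordFunctional_word m u]
          simp only [Sum.elim_inl, id, one_mul, mul_one, mul_assoc]
          rfl
        · simp
      · simp only [mul_add, map_add, hx, hy]
      · simp only [mul_smul_comm, map_smul, hx]
    · simp only [add_mul, map_add, hx, hy, TensorProduct.tmul_add]
    · simp only [smul_mul_assoc, map_smul, hx, TensorProduct.tmul_smul]

theorem isTracial_wordFunctional {X : Type*} {m : List X → ℂ}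
    (hm : ∀ u v, m (u ++ v) = m (v ++ u)) : IsTracial (wordFunctional m) := by
  intro x y
  refine freeAlgebra_word_induction (p := fun x => wordFunctional m (x * y) =
    wordFunctional m (y * x)) (fun u => ?_) (fun x x' hx hx' => ?_) (fun z x hx => ?_) x
  · refine freeAlgebra_word_induction (p := fun y => wordFunctional m (_ * y) =
      wordFunctional m (y * _)) (fun v => ?_) (fun y y' hy hy' => ?_) (fun z y hy => ?_) y
    · rw [← List.prod_append, ← List.prod_append, ← List.map_append, ← List.map_append,
        wordFunctional_word, wordFunctional_word, hm]
    · rw [mul_add, add_mul, map_add, map_add, hy, hy']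
    · rw [mul_smul_comm, smul_mul_assoc, map_smul, map_smul, hy]
  · rw [mul_add, add_mul, map_add, map_add, hx, hx']
  · rw [mul_smul_comm, smul_mul_assoc, map_smul, map_smul, hx]

/-- A functional that satisfies the recursion of Schwinger and Dyson is a free limit. -/
theorem IsSchwingerDyson.isFreeLimit {C : K → Matrix L L ℝ}
    {μ : FreeAlgebra ℂ ((K × L) ⊕ K') →ₗ[ℂ] ℂ} (h : IsSchwingerDyson μ (unionCovariance C))
    {A : Type*} [Ring A] {φ : A → ℂ} {d : K' → A}
    (hd : SameDistribution μ (fun k' => FreeAlgebra.ι ℂ (Sum.inr k')) φ d) :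
    IsFreeLimit C φ d μ (fun k l => FreeAlgebra.ι ℂ (Sum.inl (k, l)))
      (fun k' => FreeAlgebra.ι ℂ (Sum.inr k')) where
  semicircular k n i := by
    have h1 := eq_ncSum_of_recursion
      (ν := fun r => μ (r.map fun l => FreeAlgebra.ι ℂ (Sum.inl (k, l) : (K × L) ⊕ K')).prod)
      (c := fun l l' => unionCovariance C (k, l) (k, l')) (by simpa using h.one)
      (fun l r => h.recursion_word k l r) i
    rw [← sum_isNCPairing] at h1
    rw [List.map_ofFn] at h1
    simp only [unionCovariance, if_true] at h1
    exact h1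
  sameDistribution := hd
  free := h.isFree

theorem lift_mem_of_mem_letterSubalgebra {B : Type*} [Ring B] [Algebra ℂ B] (s : K → L → B)
    (d' : K' → B) (o : Option K) {x : FreeAlgebra ℂ ((K × L) ⊕ K')}
    (hx : x ∈ letterSubalgebra o) :
    FreeAlgebra.lift ℂ (Sum.elim (fun q : K × L => s q.1 q.2) d') x ∈
      (o.elim (Algebra.adjoin ℂ (Set.range d')) fun k => Algebra.adjoin ℂ (Set.range (s k)) :
        Subalgebra ℂ B) := by
  set η := FreeAlgebra.lift ℂ (Sum.elim (fun q : K × L => s q.1 q.2) d') with hη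
  suffices H : letterSubalgebra o ≤ Subalgebra.comap η (o.elim (Algebra.adjoin ℂ (Set.range d'))
      fun k => Algebra.adjoin ℂ (Set.range (s k))) from H hx
  rcases o with _ | k
  · refine Algebra.adjoin_le ?_
    rintro _ ⟨k', rfl⟩
    have : η (FreeAlgebra.ι ℂ (Sum.inr k')) = d' k' := by simp [hη]
    exact (congrArg (· ∈ Algebra.adjoin ℂ (Set.range d')) this).mpr
      (Algebra.subset_adjoin ⟨k', rfl⟩)
  · refine Algebra.adjoin_le ?_
    rintro _ ⟨l, rfl⟩
    have : η (FreeAlgebra.ι ℂ (Sum.inl (k, l))) = s k l := by simp [hη]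
    exact (congrArg (· ∈ Algebra.adjoin ℂ (Set.range (s k))) this).mpr
      (Algebra.subset_adjoin ⟨l, rfl⟩)

/-- The joint moments of a free limit are determined. -/
theorem IsFreeLimit.sameDistribution_of_isFreeLimit {C : K → Matrix L L ℝ}
    {A : Type*} [Ring A] {φ : A → ℂ} {d : K' → A}
    {B₁ B₂ : Type*} [Ring B₁] [Algebra ℂ B₁] [Ring B₂] [Algebra ℂ B₂]
    {ψ₁ : B₁ →ₗ[ℂ] ℂ} {ψ₂ : B₂ →ₗ[ℂ] ℂ} {s₁ : K → L → B₁} {s₂ : K → L → B₂}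
    {d₁ : K' → B₁} {d₂ : K' → B₂} (h₁ : IsFreeLimit C φ d ψ₁ s₁ d₁)
    (h₂ : IsFreeLimit C φ d ψ₂ s₂ d₂) (hone₁ : ψ₁ 1 = 1) (hone₂ : ψ₂ 1 = 1) :
    SameDistribution ψ₁ (Sum.elim (fun q : K × L => s₁ q.1 q.2) d₁)
      ψ₂ (Sum.elim (fun q : K × L => s₂ q.1 q.2) d₂) := by
  intro w
  set η₁ := FreeAlgebra.lift ℂ (Sum.elim (fun q : K × L => s₁ q.1 q.2) d₁) with hη₁
  set η₂ := FreeAlgebra.lift ℂ (Sum.elim (fun q : K × L => s₂ q.1 q.2) d₂) with hη₂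
  have hsub : ∀ o : Option K, ∀ x ∈ letterSubalgebra o, ψ₁ (η₁ x) = ψ₂ (η₂ x) := by
    rintro (_ | k) x hx
    · refine mem_adjoin_range_induction (p := fun x => ψ₁ (η₁ x) = ψ₂ (η₂ x)) _ (fun r => ?_)
        (fun x y hx hy => ?_) (fun z x hx => ?_) hx
      · have := (h₁.sameDistribution r).trans (h₂.sameDistribution r).symm
        simpa [jointMoment, hη₁, hη₂, map_list_prod, Function.comp_def] using this
      · simp only [map_add, hx, hy]
      · simp only [map_smul, hx]
    · refine mem_adjoin_range_induction (p := fun x => ψ₁ (η₁ x) = ψ₂ (η₂ x)) _ (fun r => ?_)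
        (fun x y hx hy => ?_) (fun z x hx => ?_) hx
      · have := (h₁.semicircular k r.length r.get).trans (h₂.semicircular k r.length r.get).symm
        have e₁ : (List.ofFn fun p => s₁ k (r.get p)) = r.map (s₁ k) := by
          rw [← Function.comp_def, ← List.map_ofFn, List.ofFn_get]
        have e₂ : (List.ofFn fun p => s₂ k (r.get p)) = r.map (s₂ k) := by
          rw [← Function.comp_def, ← List.map_ofFn, List.ofFn_get]
        rw [e₁, e₂] at this
        simpa [hη₁, hη₂, map_list_prod, Function.comp_def] using this
      · simp only [map_add, hx, hy]
      · simp only [map_smul, hx]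
  have key := IsFree.eq_on_products (μ₁ := ψ₁ ∘ₗ η₁.toLinearMap) (μ₂ := ψ₂ ∘ₗ η₂.toLinearMap)
    (h₁.free.comp η₁ fun o x hx => lift_mem_of_mem_letterSubalgebra s₁ d₁ o hx)
    (h₂.free.comp η₂ fun o x hx => lift_mem_of_mem_letterSubalgebra s₂ d₂ o hx)
    (by simp [hone₁]) (by simp [hone₂]) hsub
    (w.map fun x => (Sum.elim (fun q => some q.1) (fun _ => none) x, FreeAlgebra.ι ℂ x)) (by
      intro x hx
      obtain ⟨y, _, rfl⟩ := List.mem_map.1 hx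
      rcases y with ⟨k, l⟩ | k'
      · exact Algebra.subset_adjoin ⟨l, rfl⟩
      · exact Algebra.subset_adjoin ⟨k', rfl⟩)
  simpa [jointMoment, hη₁, hη₂, map_list_prod, Function.comp_def] using key

end Main

end FreeProb

theorem theorem2p6
    {I : Type uI} {J : Type uJ} {K : Type uK} {K' : Type uK'}
    (C : K → Matrix (I ⊕ J) (I ⊕ J) ℝ) (hC : ∀ k, (C k).PosSemidef)
    {Ω : ℕ → Type uΩ} [∀ N, MeasurableSpace (Ω N)]
    (P : ∀ N, MeasureTheory.Measure (Ω N)) [∀ N, MeasureTheory.IsProbabilityMeasure (P N)]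
    (Y : ∀ N, K → I ⊕ J → Matrix (Fin N) (Fin N) (Ω N → ℂ))
    (hY : ∀ k, FreeProb.IsSelfAdjointRandomFamily P (C k) (fun N => Y N k))
    (hYjoint : FreeProb.JointConditions P Y)
    (δ : ∀ N, K' → Fin N → ℂ)
    (hδ : ∀ k', ∃ M : ℝ, ∀ N i, ‖δ N k' i‖ ≤ M)
    {A : Type uA} [Ring A] [Algebra ℂ A] (φ : A →ₗ[ℂ] ℂ) (hφ : φ 1 = 1) (d : K' → A)
    (hd : FreeProb.ConvergesInDistribution
      (fun N => FreeProb.normTrace (N := N)) (fun N k' => Matrix.diagonal (δ N k')) φ d) :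
    -- the free limit exists, in a tracial non-commutative probability space
    (∃ (B : Type (max uI uJ uK uK')) (_ : Ring B) (_ : Algebra ℂ B) (ψ : B →ₗ[ℂ] ℂ)
        (s : K → I ⊕ J → B) (d' : K' → B),
      ψ 1 = 1 ∧ FreeProb.IsTracial ψ ∧ FreeProb.IsFreeLimit C φ d ψ s d') ∧
    -- and the joint distribution converges to it, however it is realized
    (∀ (B : Type uB) [Ring B] [Algebra ℂ B] (ψ : B →ₗ[ℂ] ℂ) (_ : ψ 1 = 1)
        (s : K → I ⊕ J → B) (d' : K' → B),
      FreeProb.IsFreeLimit C φ d ψ s d' →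
      FreeProb.ConvergesInDistribution
        (fun N => FreeProb.meanNormTrace (P N) (N := N))
        (fun N => Sum.elim (fun q : K × (I ⊕ J) => Y N q.1 q.2)
          (fun k' => FreeProb.constMatrix (Ω N) (Matrix.diagonal (δ N k'))))
        ψ (Sum.elim (fun q : K × (I ⊕ J) => s q.1 q.2) d')) := by
  obtain ⟨m, hm, hbase, hrec, hcomm⟩ := hYjoint.exists_limit hY hδ hd
  have hone : m [] = 1 := by simpa [FreeProb.jointMoment, hφ] using hbase []
  have hSD := FreeProb.isSchwingerDyson_wordFunctional hone
    (fun a b hab => by simp [FreeProb.unionCovariance, hab]) hrec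
  have hlim := hSD.isFreeLimit (φ := φ) (d := d) fun l => by
    rw [← hbase l, ← FreeProb.wordFunctional_word m (l.map Sum.inr), List.map_map]
    rfl
  refine ⟨⟨FreeAlgebra ℂ ((K × (I ⊕ J)) ⊕ K'), inferInstance, inferInstance,
    FreeProb.wordFunctional m, _, _, hSD.one, FreeProb.isTracial_wordFunctional hcomm, hlim⟩, ?_⟩
  intro B _ _ ψ hψ s d' hB w
  rw [← hlim.sameDistribution_of_isFreeLimit hB hSD.one hψ w]
  have hw : FreeProb.jointMoment (FreeProb.wordFunctional m) (Sum.elim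
      (fun q : K × (I ⊕ J) => FreeAlgebra.ι ℂ (Sum.inl (q.1, q.2)))
      fun k' => FreeAlgebra.ι ℂ (Sum.inr k')) w = m w := by
    rw [← FreeProb.wordFunctional_word m w, FreeProb.jointMoment]
    congr 3
    funext x
    rcases x with q | k' <;> rfl
  rw [hw]
  exact hm w
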